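/- Let $p\in[1,\infty)$, let $G$ be a countable discrete abelian group with counting measure, and let $\hat G$ be its (compact) dual group with normalized Haar measure $\mu$. Let $A$ be a separable unital $L^p$ operator algebra (a Banach algebra with an isometric representation on some $L^p$ space) which has unique $L^p$ operator matrix norms: any two isometric representations of $A$ on separable $L^p$ spaces of $\sigma$-finite measures induce the same norms on all matrix algebras $M_n(A)$, where a matrix of operators on $L^p(X,\nu)$ acts on $L^p(\{1,\dots,n\}\times X)$. Let $\alpha$ be an action of $G$ on $A$ by isometric automorphisms. For a locally compact group $K$ with left Haar measure $\mu_K$ and a strongly continuous action $\tau$ of $K$ on a Banach algebra $B$ by isometric automorphisms, let $F^p(K,B,\tau)$ denote the full $L^p$ operator crossed product: the (Hausdorff) completion of $C_c(K,B)$, with the twisted convolution $(f*g)(t)=\int_K f(s)\,\tau_s(g(s^{-1}t))\,d\mu_K(s)$, in the seminorm $\|f\|=\sup\|(\pi\rtimes v)(f)\|$, where $(\pi\rtimes v)(f)\xi=\int_K\pi(f(t))v_t\xi\,d\mu_K(t)$ and the supremum runs over all pairs $(\pi,v)$ consisting of a nondegenerate contractive representation $\pi$ of $B$ on the $L^p$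 space of a $\sigma$-finite measure and a strongly continuous representation $v$ of $K$ by invertible isometries of the same space with $v_t\pi(b)v_{t^{-1}}=\pi(\tau_t(b))$. Let $\hat\alpha$ be the action of $\hat G$ on $F^p(G,A,\alpha)$ determined by $\hat\alpha_\gamma(f)(s)=\overline{\gamma(s)}f(s)$ for $f\in C_c(G,A)$, let $\beta$ be the trivial action of $\hat G$ on $A$, and let $\hat\beta\otimes\alpha$ be the action of $G$ on $F^p(\hat G,A,\beta)$ determined by $(\hat\beta\otimes\alpha)_s(\varphi)(\gamma)=\gamma(s)\,\alpha_s(\varphi(\gamma))$ for $\varphi\in C(\hat G,A)$. A function $F\in C_c(\hat G\times G,A)$ defines the element $\gamma\mapsto F(\gamma,\cdot)$ of $F^p(\hat G,F^p(G,A,\alpha),\hat\alpha)$, and a function in $C_c(G\times\hat G,A)$ defines in the same way an element of $F^p(G,F^p(\hat G,A,\beta),\hat\beta\otimes\alpha)$. **Proposition (label change).** The map $$\Phi_1(F)(s,\gamma)=\gamma(s)F(\gamma,s),\qquad F\in C_c(\hat G\times G,A),\ s\in G,\ \gamma\in\hat G,$$ extends uniquely to an isometric algebra isomorphism $$\Phi_1:F^p(\hat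 G,F^p(G,A,\alpha),\hat\alpha)\longrightarrow F^p(G,F^p(\hat G,A,\beta),\hat\beta\otimes\alpha)$$ of the first algebra onto the second. -/

import Mathlib

open MeasureTheory Topology UniformSpace
open scoped ENNReal CompactlySupported

universe u v w

noncomputable section

namespace LpCrossed

/-! ### Generic facts about completions and strongly continuous families of isometries -/

section Generic

variable (R : Type u) [NonUnitalSeminormedRing R]

/-- The extension by continuity of the product of a (non-unital) seminormed ring to its
completion. -/
def completionMul : Completion R → Completion R → Completion R :=
  Function.curry <| (Completion.isDenseInducing_coe.prodMap Completion.isDenseInducing_coe).extend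
    ((fun x : R => (x : Completion R)) ∘ Function.uncurry (fun x y : R => x * y))

variable {R} in
theorem completionMul_coe (a b : R) :
    completionMul R (a : Completion R) (b : Completion R) = ((a * b : R) : Completion R) :=
  (Completion.isDenseInducing_coe.prodMap Completion.isDenseInducing_coe).extend_eq
    ((Completion.continuous_coe R).comp (continuous_mul (M := R))) (a, b)

theorem continuous_completionMul :
    Continuous fun q : Completion R × Completion R => completionMul R q.1 q.2 := by
  let m := (AddMonoidHom.mul : R →+ R →+ R).compr₂ Completion.toCompl
  have hm : Continuous fun q : R × R => m q.1 q.2 :=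
    (Completion.continuous_coe R).comp continuous_mul
  have di : IsDenseInducing (Completion.toCompl : R → Completion R) :=
    Completion.isDenseInducing_coe
  exact (di.extend_Z_bilin di hm :)

variable {R} in
theorem continuous_completionMul_comp {T : Type*} [TopologicalSpace T] {f g : T → Completion R}
    (hf : Continuous f) (hg : Continuous g) : Continuous fun t => completionMul R (f t) (g t) :=
  (continuous_completionMul R).comp (hf.prodMk hg)

variable {R} in
theorem completionMul_assoc (a b c : Completion R) :
    completionMul R (completionMul R a b) c = completionMul R a (completionMul R b c) := by
  refine Completion.induction_on₃ a b c (isClosed_eq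
    (continuous_completionMul_comp (continuous_completionMul_comp continuous_fst
      continuous_snd.fst) continuous_snd.snd)
    (continuous_completionMul_comp continuous_fst
      (continuous_completionMul_comp continuous_snd.fst continuous_snd.snd))) fun a b c => ?_
  simp only [completionMul_coe, mul_assoc]

variable {R} in
theorem completionMul_add (a b c : Completion R) :
    completionMul R a (b + c) = completionMul R a b + completionMul R a c := by
  refine Completion.induction_on₃ a b c (isClosed_eq
    (continuous_completionMul_comp continuous_fst (continuous_snd.fst.add continuous_snd.snd))
    ((continuous_completionMul_comp continuous_fst continuous_snd.fst).add
      (continuous_completionMul_comp continuous_fst continuous_snd.snd))) fun a b c => ?_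
  simp only [completionMul_coe, ← Completion.coe_add, mul_add]

variable {R} in
theorem add_completionMul (a b c : Completion R) :
    completionMul R (a + b) c = completionMul R a c + completionMul R b c := by
  refine Completion.induction_on₃ a b c (isClosed_eq
    (continuous_completionMul_comp (continuous_fst.add continuous_snd.fst) continuous_snd.snd)
    ((continuous_completionMul_comp continuous_fst continuous_snd.snd).add
      (continuous_completionMul_comp continuous_snd.fst continuous_snd.snd))) fun a b c => ?_
  simp only [completionMul_coe, ← Completion.coe_add, add_mul]

variable {R} in
theorem norm_completionMul_le (a b : Completion R) : ‖completionMul R a b‖ ≤ ‖a‖ * ‖b‖ := by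
  refine Completion.induction_on₂ a b (isClosed_le
    (continuous_completionMul R).norm (by fun_prop)) fun a b => ?_
  rw [completionMul_coe, Completion.norm_coe, Completion.norm_coe, Completion.norm_coe]
  exact norm_mul_le a b

variable {R} in
theorem completionMul_zero (a : Completion R) : completionMul R a 0 = 0 := by
  have := completionMul_add a 0 0
  rwa [add_zero, left_eq_add] at this

variable {R} in
theorem zero_completionMul (a : Completion R) : completionMul R 0 a = 0 := by
  have := add_completionMul 0 0 a
  rwa [add_zero, left_eq_add] at this

/-- A strongly continuous family of linear isometries is jointly continuous. -/
theorem continuous_isometry_apply {T E : Type*} [TopologicalSpace T] [NormedAddCommGroup E]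
    [NormedSpace ℂ E] (V : T → E ≃ₗᵢ[ℂ] E) (hV : ∀ x, Continuous fun t => V t x) :
    Continuous fun q : T × E => V q.1 q.2 := by
  rw [continuous_iff_continuousAt]
  rintro ⟨t₀, x₀⟩
  rw [ContinuousAt, tendsto_iff_norm_sub_tendsto_zero]
  have h1 : Filter.Tendsto (fun q : T × E => ‖q.2 - x₀‖ + ‖V q.1 x₀ - V t₀ x₀‖) (𝓝 (t₀, x₀))
      (𝓝 0) := by
    have : Continuous fun q : T × E => ‖q.2 - x₀‖ + ‖V q.1 x₀ - V t₀ x₀‖ := by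
      have := (hV x₀).comp (continuous_fst : Continuous (Prod.fst : T × E → T))
      simp only [Function.comp_def] at this
      fun_prop
    simpa using this.tendsto (t₀, x₀)
  refine squeeze_zero (fun _ => norm_nonneg _) (fun q => ?_) h1
  have h2 := norm_sub_le_norm_sub_add_norm_sub (V q.1 q.2) (V q.1 x₀) (V t₀ x₀)
  rwa [← LinearIsometryEquiv.map_sub, LinearIsometryEquiv.norm_map] at h2

/-- A continuous function vanishing outside a compact set of pairs `(r * s, r)`. -/
theorem hasCompactSupport_of_convolution {G F E : Type*} [Group G] [TopologicalSpace G]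
    [IsTopologicalGroup G] [Zero F] [Zero E] [TopologicalSpace F] (f g : C_c(G, F))
    {Ψ : G × G → E} (h : ∀ s r, (f r = 0 ∨ g (r⁻¹ * s) = 0) → Ψ (s, r) = 0) :
    HasCompactSupport Ψ := by
  have hK : IsCompact ((fun q : G × G => (q.1 * q.2, q.1)) '' (tsupport f ×ˢ tsupport g)) :=
    (f.hasCompactSupport.isCompact.prod g.hasCompactSupport.isCompact).image (by fun_prop)
  refine HasCompactSupport.intro hK ?_
  rintro ⟨s, r⟩ hq
  apply h
  by_contra hcon
  push Not at hcon
  exact hq ⟨(r, r⁻¹ * s), ⟨subset_tsupport _ hcon.1, subset_tsupport _ hcon.2⟩, by simp⟩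

end Generic

/-! ### Actions, covariant representations, and the convolution algebra -/

/-- A continuous action of a topological group on a Banach algebra by isometric
automorphisms. -/
structure IsoAction (G : Type u) (A : Type v) [Group G] [TopologicalSpace G]
    [NonUnitalNormedRing A] [NormedSpace ℂ A] where
  /-- the underlying homomorphism into the group of linear isometries -/
  toHom : G →* (A ≃ₗᵢ[ℂ] A)
  map_mul' : ∀ g a b, toHom g (a * b) = toHom g a * toHom g b
  continuous' : ∀ a, Continuous fun g => toHom g a

section Basic

variable {G : Type u} [Group G] [TopologicalSpace G]
  {A : Type v} [NonUnitalNormedRing A] [NormedSpace ℂ A]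

namespace IsoAction

instance : CoeFun (IsoAction G A) fun _ => G → (A ≃ₗᵢ[ℂ] A) := ⟨fun α => α.toHom⟩

variable (α : IsoAction G A)

theorem apply_mul (g h : G) (a : A) : α (g * h) a = α g (α h a) := by
  rw [map_mul]; rfl

theorem joint : Continuous fun q : G × A => α q.1 q.2 :=
  continuous_isometry_apply _ α.continuous'

variable (G A) in
/-- The trivial action. -/
def trivial : IsoAction G A where
  toHom := 1
  map_mul' _ _ _ := rfl
  continuous' _ := continuous_const

@[simp] theorem trivial_apply (g : G) (a : A) : trivial G A g a = a := rfl

end IsoAction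

variable (p : ℝ≥0∞) [Fact (1 ≤ p)]

/-- A nondegenerate `σ`-finite contractive covariant representation of `(G, A, α)` on an
`L^p` space. -/
structure CovRep (α : IsoAction G A) : Type (max u v (w + 1)) where
  /-- the underlying space -/
  X : Type w
  [mX : MeasurableSpace X]
  /-- the measure -/
  ν : Measure X
  [sigmaFinite : SigmaFinite ν]
  /-- the representation of the algebra -/
  π : A →ₙₐ[ℂ] (Lp ℂ p ν →L[ℂ] Lp ℂ p ν)
  contractive : ∀ a, ‖π a‖ ≤ ‖a‖
  nondegenerate : (Submodule.span ℂ {η | ∃ a ξ, η = π a ξ}).topologicalClosure = ⊤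
  /-- the isometric representation of the group -/
  V : G →* (Lp ℂ p ν ≃ₗᵢ[ℂ] Lp ℂ p ν)
  continuous_V : ∀ ξ, Continuous fun t => V t ξ
  covariant : ∀ t a ξ, V t (π a (V t⁻¹ ξ)) = π (α t a) ξ

namespace CovRep

attribute [instance] CovRep.mX CovRep.sigmaFinite

variable {p} {α : IsoAction G A} (ρ : CovRep.{u, v, w} p α)

/-- The `L^p` space on which a covariant representation acts. -/
abbrev E : Type w := Lp ℂ p ρ.ν

/-- The representation of the algebra as a bounded linear map. -/
def πL : A →L[ℂ] (ρ.E →L[ℂ] ρ.E) :=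
  LinearMap.mkContinuous
    { toFun := ρ.π
      map_add' := map_add ρ.π
      map_smul' := fun c a => map_smul ρ.π c a } 1
    (fun a => by simpa using ρ.contractive a)

@[simp] theorem πL_apply (a : A) : ρ.πL a = ρ.π a := rfl

theorem norm_π_apply_le (a : A) (ξ : ρ.E) : ‖ρ.π a ξ‖ ≤ ‖a‖ * ‖ξ‖ :=
  ((ρ.π a).le_opNorm ξ).trans (by gcongr; exact ρ.contractive a)

theorem joint_V : Continuous fun q : G × ρ.E => ρ.V q.1 q.2 :=
  continuous_isometry_apply _ ρ.continuous_V

theorem V_mul (s t : G) (ξ : ρ.E) : ρ.V (s * t) ξ = ρ.V s (ρ.V t ξ) := by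
  rw [map_mul]; rfl

theorem V_π (t : G) (a : A) (ξ : ρ.E) : ρ.V t (ρ.π a ξ) = ρ.π (α t a) (ρ.V t ξ) := by
  rw [← ρ.covariant, ← V_mul, inv_mul_cancel, map_one]; rfl

theorem continuous_integrand {T : Type*} [TopologicalSpace T] {b : T → A} {τ : T → G}
    {x : T → ρ.E} (hb : Continuous b) (hτ : Continuous τ) (hx : Continuous x) :
    Continuous fun t => ρ.π (b t) (ρ.V (τ t) (x t)) := by
  have h2 : Continuous fun t => ρ.V (τ t) (x t) := ρ.joint_V.comp (hτ.prodMk hx)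
  exact (ρ.πL.continuous.comp hb).clm_apply h2

variable [MeasurableSpace G] [BorelSpace G] (μ : Measure G)
  [μ.IsHaarMeasure]

theorem integrable_integrand (f : C_c(G, A)) (ξ : ρ.E) :
    Integrable (fun t => ρ.π (f t) (ρ.V t ξ)) μ :=
  (ρ.continuous_integrand f.continuous continuous_id continuous_const).integrable_of_hasCompactSupport
    (f.hasCompactSupport.mono fun t ht => by
      contrapose! ht
      simp only [Function.mem_support, not_not] at ht ⊢
      simp [ht])

theorem integrable_norm (f : C_c(G, A)) : Integrable (fun t => ‖f t‖) μ :=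
  (f.continuous.integrable_of_hasCompactSupport f.hasCompactSupport).norm

/-- The integrated form of a covariant representation,
`f ↦ (ξ ↦ ∫ π(f t) (V_t ξ) dμ(t))`. -/
def integrated (f : C_c(G, A)) : ρ.E →L[ℂ] ρ.E :=
  LinearMap.mkContinuous
    { toFun := fun ξ => ∫ t, ρ.π (f t) (ρ.V t ξ) ∂μ
      map_add' := fun ξ η => by
        simp only [map_add]
        exact integral_add (ρ.integrable_integrand μ f ξ) (ρ.integrable_integrand μ f η)
      map_smul' := fun c ξ => by
        simp only [map_smul, RingHom.id_apply]
        exact integral_smul c _ } (∫ t, ‖f t‖ ∂μ)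
    (fun ξ => by
      simp only [LinearMap.coe_mk, AddHom.coe_mk]
      rw [← integral_mul_const]
      refine norm_integral_le_of_norm_le ((integrable_norm μ f).mul_const _)
        (Filter.Eventually.of_forall fun t => ?_)
      simpa using ρ.norm_π_apply_le (f t) (ρ.V t ξ))

theorem integrated_apply (f : C_c(G, A)) (ξ : ρ.E) :
    ρ.integrated μ f ξ = ∫ t, ρ.π (f t) (ρ.V t ξ) ∂μ := rfl

theorem norm_integrated_le (f : C_c(G, A)) : ‖ρ.integrated μ f‖ ≤ ∫ t, ‖f t‖ ∂μ :=
  LinearMap.mkContinuous_norm_le _ (integral_nonneg fun _ => norm_nonneg _) _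

theorem integrated_add (f g : C_c(G, A)) :
    ρ.integrated μ (f + g) = ρ.integrated μ f + ρ.integrated μ g := by
  ext1 ξ
  simp only [integrated_apply, add_apply,
    CompactlySupportedContinuousMap.coe_add, Pi.add_apply, map_add]
  exact integral_add (ρ.integrable_integrand μ f ξ) (ρ.integrable_integrand μ g ξ)

theorem integrated_smul (c : ℂ) (f : C_c(G, A)) :
    ρ.integrated μ (c • f) = c • ρ.integrated μ f := by
  ext1 ξ
  simp only [integrated_apply, smul_apply,
    CompactlySupportedContinuousMap.coe_smul, Pi.smul_apply, map_smul]
  exact integral_smul c _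

end CovRep

/-- The algebra `C_c(G, A, α)` of continuous compactly supported functions `G → A`: a type synonym
of `C_c(G, A)` that carries the twisted convolution product and the full `L^p` crossed product
seminorm. The seminorm depends on `p`, on `μ` and on the universe `w` of the measure spaces allowed
in covariant representations, so these are recorded in the name of the type; the constant function
in the body does nothing but record `w`. -/
@[nolint unusedArguments]
def ConvAlg (_p : ℝ≥0∞) [MeasurableSpace G] (_μ : Measure G) (_α : IsoAction G A) : Type (max u v) :=
  Function.const (Type w) C_c(G, A) PUnit

namespace ConvAlg

section Add

variable {p} [MeasurableSpace G] {μ : Measure G} {α : IsoAction G A}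

instance : AddCommGroup (ConvAlg.{u, v, w} p μ α) := inferInstanceAs (AddCommGroup C_c(G, A))

instance : Module ℂ (ConvAlg.{u, v, w} p μ α) := inferInstanceAs (Module ℂ C_c(G, A))

/-- The underlying function. -/
def toFn : ConvAlg.{u, v, w} p μ α ≃ₗ[ℂ] C_c(G, A) := LinearEquiv.refl ℂ C_c(G, A)

end Add

variable [IsTopologicalGroup G] [MeasurableSpace G] [BorelSpace G] {μ : Measure G}
  [μ.IsHaarMeasure] (α : IsoAction G A)

section ConvFun

theorem continuous_convKernel (f g : C_c(G, A)) :
    Continuous fun q : G × G => f q.2 * α q.2 (g (q.2⁻¹ * q.1)) := by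
  have h : Continuous fun q : G × G => α q.2 (g (q.2⁻¹ * q.1)) :=
    α.joint.comp (continuous_snd.prodMk (g.continuous.comp (by fun_prop)))
  exact (f.continuous.comp continuous_snd).mul h

theorem hasCompactSupport_convKernel (f g : C_c(G, A)) :
    HasCompactSupport fun q : G × G => f q.2 * α q.2 (g (q.2⁻¹ * q.1)) := by
  refine hasCompactSupport_of_convolution f g ?_
  rintro s r (h | h) <;> simp [h]

variable (μ) in
/-- The twisted convolution `(f * g)(t) = ∫ f(s) α_s(g(s⁻¹ t)) dμ(s)`. -/
def conv (f g : C_c(G, A)) : C_c(G, A) where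
  toFun t := ∫ s, f s * α s (g (s⁻¹ * t)) ∂μ
  continuous_toFun := by
    rw [← continuousOn_univ]
    refine continuousOn_integral_of_compact_support f.hasCompactSupport.isCompact
      (continuous_convKernel α f g).continuousOn fun t s _ hs => ?_
    rw [image_eq_zero_of_notMem_tsupport hs, zero_mul]
  hasCompactSupport' := by
    refine HasCompactSupport.intro
      ((hasCompactSupport_convKernel α f g).isCompact.image continuous_fst) fun t ht => ?_
    rw [← integral_zero G A (μ := μ)]
    congr 1
    ext s
    by_contra hne
    exact ht ⟨(t, s), subset_tsupport _ hne, rfl⟩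

theorem conv_apply (f g : C_c(G, A)) (t : G) :
    conv μ α f g t = ∫ s, f s * α s (g (s⁻¹ * t)) ∂μ := rfl

theorem integrable_convKernel (f g : C_c(G, A)) (t : G) :
    Integrable (fun s => f s * α s (g (s⁻¹ * t))) μ := by
  refine ((continuous_convKernel α f g).comp (by fun_prop : Continuous fun s => (t, s))
    ).integrable_of_hasCompactSupport (HasCompactSupport.intro f.hasCompactSupport.isCompact
      fun s hs => ?_)
  simp [image_eq_zero_of_notMem_tsupport hs]

theorem conv_add (f g h : C_c(G, A)) : conv μ α f (g + h) = conv μ α f g + conv μ α f h := by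
  ext t
  simp only [conv_apply, CompactlySupportedContinuousMap.coe_add, Pi.add_apply, map_add, mul_add]
  exact integral_add (integrable_convKernel α f g t) (integrable_convKernel α f h t)

theorem add_conv (f g h : C_c(G, A)) : conv μ α (f + g) h = conv μ α f h + conv μ α g h := by
  ext t
  simp only [conv_apply, CompactlySupportedContinuousMap.coe_add, Pi.add_apply, add_mul]
  exact integral_add (integrable_convKernel α f h t) (integrable_convKernel α g h t)

variable [IsScalarTower ℂ A A] [SMulCommClass ℂ A A]

theorem smul_conv (c : ℂ) (f g : C_c(G, A)) : conv μ α (c • f) g = c • conv μ α f g := by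
  ext t
  simp only [conv_apply, CompactlySupportedContinuousMap.coe_smul, Pi.smul_apply, smul_mul_assoc]
  exact integral_smul c _

theorem conv_smul (c : ℂ) (f g : C_c(G, A)) : conv μ α f (c • g) = c • conv μ α f g := by
  ext t
  simp only [conv_apply, CompactlySupportedContinuousMap.coe_smul, Pi.smul_apply, map_smul,
    mul_smul_comm]
  exact integral_smul c _

variable [CompleteSpace A]

theorem conv_assoc (f g h : C_c(G, A)) :
    conv μ α (conv μ α f g) h = conv μ α f (conv μ α g h) := by
  ext t
  have h1 : ∀ s, conv μ α f g s * α s (h (s⁻¹ * t)) =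
      ∫ r, f r * α r (g (r⁻¹ * s)) * α s (h (s⁻¹ * t)) ∂μ := fun s =>
    ((((ContinuousLinearMap.mul ℂ A).flip (α s (h (s⁻¹ * t)))).integral_comp_comm
      (integrable_convKernel (μ := μ) α f g s))).symm
  have h2 : ∀ r, f r * α r (conv μ α g h (r⁻¹ * t)) =
      ∫ s, f r * α r (g s * α s (h (s⁻¹ * (r⁻¹ * t)))) ∂μ := fun r =>
    (((ContinuousLinearMap.mul ℂ A (f r)).comp
      (α r).toContinuousLinearEquiv.toContinuousLinearMap).integral_comp_comm
      (integrable_convKernel (μ := μ) α g h (r⁻¹ * t))).symm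
  rw [conv_apply, conv_apply]
  simp only [h1, h2]
  rw [integral_integral_swap_of_hasCompactSupport]
  · refine integral_congr_ae (Filter.Eventually.of_forall fun r => ?_)
    simp only
    rw [← integral_mul_left_eq_self _ r]
    refine integral_congr_ae (Filter.Eventually.of_forall fun s => ?_)
    simp only [inv_mul_cancel_left, α.map_mul', α.apply_mul, mul_inv_rev, mul_assoc]
  · have h3 : Continuous fun q : G × G => α q.1 (h (q.1⁻¹ * t)) :=
      α.joint.comp (continuous_fst.prodMk (h.continuous.comp (by fun_prop)))
    exact (continuous_convKernel α f g).mul h3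
  · refine hasCompactSupport_of_convolution f g ?_
    rintro s r (h | h) <;> simp [h]

theorem integrated_conv {α : IsoAction G A} (ρ : CovRep.{u, v, w} p α) (f g : C_c(G, A)) :
    ρ.integrated μ (conv μ α f g) = ρ.integrated μ f * ρ.integrated μ g := by
  ext1 ξ
  have h1 : ∀ t, ρ.π (conv μ α f g t) (ρ.V t ξ) =
      ∫ s, ρ.π (f s * α s (g (s⁻¹ * t))) (ρ.V t ξ) ∂μ := fun t =>
    ((((ContinuousLinearMap.apply ℂ ρ.E (ρ.V t ξ)).comp ρ.πL).integral_comp_comm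
      (integrable_convKernel (μ := μ) α f g t))).symm
  have h2 : ∀ s, ρ.π (f s) (ρ.V s (ρ.integrated μ g ξ)) =
      ∫ t, ρ.π (f s) (ρ.V s (ρ.π (g t) (ρ.V t ξ))) ∂μ := fun s =>
    (((ρ.π (f s)).comp
      (ρ.V s).toContinuousLinearEquiv.toContinuousLinearMap).integral_comp_comm
      (ρ.integrable_integrand μ g ξ)).symm
  change _ = ρ.integrated μ f (ρ.integrated μ g ξ)
  rw [ρ.integrated_apply, ρ.integrated_apply μ f]
  simp only [h1, h2]
  rw [integral_integral_swap_of_hasCompactSupport]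
  · refine integral_congr_ae (Filter.Eventually.of_forall fun s => ?_)
    simp only
    rw [← integral_mul_left_eq_self _ s]
    refine integral_congr_ae (Filter.Eventually.of_forall fun t => ?_)
    simp only [inv_mul_cancel_left, ρ.V_π, map_mul]
    rfl
  · exact ρ.continuous_integrand (continuous_convKernel α f g) continuous_fst continuous_const
  · refine hasCompactSupport_of_convolution f g ?_
    rintro s r (h | h) <;> simp [h]

end ConvFun

/-! The seminorm and the ring structure. -/

section Ring

variable {p} {α}

theorem bddAbove_integrated (f : ConvAlg.{u, v, w} p μ α) :
    BddAbove (Set.range fun ρ : CovRep.{u, v, w} p α => ‖ρ.integrated μ (toFn f)‖) :=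
  ⟨∫ t, ‖toFn f t‖ ∂μ, by rintro _ ⟨ρ, rfl⟩; exact ρ.norm_integrated_le μ _⟩

variable (p μ α) in
/-- The full `L^p` crossed product seminorm: the supremum of `‖(π ⋊ V)(f)‖` over all
nondegenerate `σ`-finite contractive covariant representations `(π, V)` on `L^p` spaces. -/
def seminorm : Seminorm ℂ (ConvAlg.{u, v, w} p μ α) :=
  Seminorm.of (fun f => ⨆ ρ : CovRep.{u, v, w} p α, ‖ρ.integrated μ (toFn f)‖)
    (fun f g => by
      refine Real.iSup_le (fun ρ => ?_) (add_nonneg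
        (Real.iSup_nonneg fun _ => norm_nonneg _) (Real.iSup_nonneg fun _ => norm_nonneg _))
      rw [map_add, ρ.integrated_add]
      exact (norm_add_le _ _).trans
        (add_le_add (le_ciSup (bddAbove_integrated f) ρ) (le_ciSup (bddAbove_integrated g) ρ)))
    (fun c f => by
      rw [Real.mul_iSup_of_nonneg (norm_nonneg c)]
      simp only [map_smul, CovRep.integrated_smul, norm_smul])

instance : SeminormedAddCommGroup (ConvAlg.{u, v, w} p μ α) :=
  (seminorm p μ α).toAddGroupSeminorm.toSeminormedAddCommGroup

theorem norm_def (f : ConvAlg.{u, v, w} p μ α) :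
    ‖f‖ = ⨆ ρ : CovRep.{u, v, w} p α, ‖ρ.integrated μ (toFn f)‖ := rfl

instance : NormedSpace ℂ (ConvAlg.{u, v, w} p μ α) where
  norm_smul_le c f := (map_smul_eq_mul (seminorm p μ α) c f).le

theorem norm_integrated_le_norm (ρ : CovRep.{u, v, w} p α) (f : ConvAlg.{u, v, w} p μ α) :
    ‖ρ.integrated μ (toFn f)‖ ≤ ‖f‖ :=
  le_ciSup (bddAbove_integrated f) ρ

theorem norm_le_integral (f : ConvAlg.{u, v, w} p μ α) : ‖f‖ ≤ ∫ t, ‖toFn f t‖ ∂μ :=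
  Real.iSup_le (fun ρ => ρ.norm_integrated_le μ _) (integral_nonneg fun _ => norm_nonneg _)

variable [IsScalarTower ℂ A A] [SMulCommClass ℂ A A] [CompleteSpace A]

instance : Mul (ConvAlg.{u, v, w} p μ α) := ⟨fun f g => toFn.symm (conv μ α (toFn f) (toFn g))⟩

theorem toFn_mul (f g : ConvAlg.{u, v, w} p μ α) : toFn (f * g) = conv μ α (toFn f) (toFn g) := rfl

instance : NonUnitalSeminormedRing (ConvAlg.{u, v, w} p μ α) :=
  { (inferInstance : SeminormedAddCommGroup (ConvAlg.{u, v, w} p μ α)) with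
    mul := (· * ·)
    zero_mul := fun a => toFn.injective <| by
      have := smul_conv (μ := μ) α 0 0 (toFn a)
      rwa [zero_smul, zero_smul] at this
    mul_zero := fun a => toFn.injective <| by
      have := conv_smul (μ := μ) α 0 (toFn a) 0
      rwa [zero_smul, zero_smul] at this
    mul_assoc := fun a b c => toFn.injective (conv_assoc α _ _ _)
    left_distrib := fun a b c => toFn.injective (conv_add α _ _ _)
    right_distrib := fun a b c => toFn.injective (add_conv α _ _ _)
    norm_mul_le := fun a b => by
      refine Real.iSup_le (fun ρ => ?_) (mul_nonneg (norm_nonneg a) (norm_nonneg b))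
      rw [toFn_mul, integrated_conv]
      exact (norm_mul_le _ _).trans (mul_le_mul (norm_integrated_le_norm ρ a)
        (norm_integrated_le_norm ρ b) (norm_nonneg _) (norm_nonneg a)) }

theorem smul_mul_eq (c : ℂ) (f g : ConvAlg.{u, v, w} p μ α) : c • f * g = c • (f * g) :=
  toFn.injective (smul_conv α _ _ _)

theorem mul_smul_eq (c : ℂ) (f g : ConvAlg.{u, v, w} p μ α) : f * c • g = c • (f * g) :=
  toFn.injective (conv_smul α _ _ _)

end Ring
end ConvAlg

/-! ### The full `L^p` operator crossed product -/

section Crossed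

variable [IsTopologicalGroup G] [MeasurableSpace G] [BorelSpace G] (μ : Measure G)
  [μ.IsHaarMeasure] (α : IsoAction G A)

/-- The full `L^p` operator crossed product `F^p(G, A, α)`: the completion of `C_c(G, A, α)`. -/
def LpCrossedProduct : Type (max u v) := Completion (ConvAlg.{u, v, w} p μ α)

namespace LpCrossedProduct

instance : NormedAddCommGroup (LpCrossedProduct.{u, v, w} p μ α) :=
  inferInstanceAs (NormedAddCommGroup (Completion (ConvAlg.{u, v, w} p μ α)))

instance : NormedSpace ℂ (LpCrossedProduct.{u, v, w} p μ α) :=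
  inferInstanceAs (NormedSpace ℂ (Completion (ConvAlg.{u, v, w} p μ α)))

instance : CompleteSpace (LpCrossedProduct.{u, v, w} p μ α) :=
  inferInstanceAs (CompleteSpace (Completion (ConvAlg.{u, v, w} p μ α)))

/-- The canonical map from `C_c(G, A, α)` to `F^p(G, A, α)`. -/
def ofConv : ConvAlg.{u, v, w} p μ α →ₗᵢ[ℂ] LpCrossedProduct.{u, v, w} p μ α :=
  Completion.toComplₗᵢ

theorem denseRange_ofConv : DenseRange (ofConv.{u, v, w} p μ α) :=
  Completion.denseRange_coe

/-- The element of `F^p(G, A, α)` given by a continuous compactly supported function. -/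
def ofFn (f : C_c(G, A)) : LpCrossedProduct.{u, v, w} p μ α :=
  ofConv p μ α (ConvAlg.toFn.symm f)

variable [IsScalarTower ℂ A A] [SMulCommClass ℂ A A] [CompleteSpace A]

instance : NonUnitalNormedRing (LpCrossedProduct.{u, v, w} p μ α) :=
  { (inferInstance : NormedAddCommGroup (LpCrossedProduct.{u, v, w} p μ α)) with
    mul := completionMul (ConvAlg.{u, v, w} p μ α)
    zero_mul := zero_completionMul
    mul_zero := completionMul_zero
    mul_assoc := completionMul_assoc
    left_distrib := completionMul_add
    right_distrib := add_completionMul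
    norm_mul_le := norm_completionMul_le }

variable {p μ α} in
theorem ofConv_mul (f g : ConvAlg.{u, v, w} p μ α) :
    ofConv p μ α (f * g) = ofConv p μ α f * ofConv p μ α g :=
  (completionMul_coe f g).symm

variable {p μ α} in
theorem smul_mul_aux (c : ℂ) (x y : LpCrossedProduct.{u, v, w} p μ α) :
    c • x * y = c • (x * y) := by
  have h1 : Continuous fun q : LpCrossedProduct.{u, v, w} p μ α × LpCrossedProduct.{u, v, w} p μ α
      => c • q.1 * q.2 := (continuous_fst.const_smul c).mul continuous_snd
  have h2 : Continuous fun q : LpCrossedProduct.{u, v, w} p μ α × LpCrossedProduct.{u, v, w} p μ α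
      => c • (q.1 * q.2) := (continuous_fst.mul continuous_snd).const_smul c
  refine (denseRange_ofConv p μ α).induction_on₂ (isClosed_eq h1 h2) (fun f g => ?_) x y
  rw [← map_smul, ← ofConv_mul, ← ofConv_mul, ← map_smul, ConvAlg.smul_mul_eq]

variable {p μ α} in
theorem mul_smul_aux (c : ℂ) (x y : LpCrossedProduct.{u, v, w} p μ α) :
    x * c • y = c • (x * y) := by
  have h1 : Continuous fun q : LpCrossedProduct.{u, v, w} p μ α × LpCrossedProduct.{u, v, w} p μ α
      => q.1 * c • q.2 := continuous_fst.mul (continuous_snd.const_smul c)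
  have h2 : Continuous fun q : LpCrossedProduct.{u, v, w} p μ α × LpCrossedProduct.{u, v, w} p μ α
      => c • (q.1 * q.2) := (continuous_fst.mul continuous_snd).const_smul c
  refine (denseRange_ofConv p μ α).induction_on₂ (isClosed_eq h1 h2) (fun f g => ?_) x y
  rw [← map_smul, ← ofConv_mul, ← ofConv_mul, ← map_smul, ConvAlg.mul_smul_eq]

instance : IsScalarTower ℂ (LpCrossedProduct.{u, v, w} p μ α)
    (LpCrossedProduct.{u, v, w} p μ α) := ⟨smul_mul_aux⟩

instance : SMulCommClass ℂ (LpCrossedProduct.{u, v, w} p μ α)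
    (LpCrossedProduct.{u, v, w} p μ α) := ⟨fun c x y => (mul_smul_aux c x y).symm⟩

end LpCrossedProduct

end Crossed

/-! ### Twisting by characters and commuting automorphisms -/

section Twist

theorem continuous_circle_coe : Continuous fun z : Circle => (z : ℂ) := by
  fun_prop

/-- `s ↦ χ(s) θ(f(s))`. -/
def twistFn (χ : PontryaginDual G) (θ : A ≃ₗᵢ[ℂ] A) : C_c(G, A) →ₗ[ℂ] C_c(G, A) where
  toFun f :=
    { toFun := fun s => (χ s : ℂ) • θ (f s)
      continuous_toFun :=
        (continuous_circle_coe.comp (map_continuous χ)).smul (θ.continuous.comp f.continuous)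
      hasCompactSupport' := f.hasCompactSupport.mono fun s hs => by
        contrapose! hs
        simp only [Function.mem_support, not_not] at hs ⊢
        simp [hs] }
  map_add' f g := by
    ext s
    simp
  map_smul' c f := by
    ext s
    simp [smul_comm c]

theorem twistFn_apply (χ : PontryaginDual G) (θ : A ≃ₗᵢ[ℂ] A) (f : C_c(G, A)) (s : G) :
    twistFn χ θ f s = (χ s : ℂ) • θ (f s) := rfl

theorem twistFn_one (f : C_c(G, A)) : twistFn (1 : PontryaginDual G) 1 f = f := by
  ext s
  simp [twistFn_apply]

theorem twistFn_mul (χ χ' : PontryaginDual G) (θ θ' : A ≃ₗᵢ[ℂ] A) (f : C_c(G, A)) :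
    twistFn (χ * χ') (θ * θ') f = twistFn χ θ (twistFn χ' θ' f) := by
  ext s
  have : (χ * χ') s = χ s * χ' s := rfl
  simp [twistFn_apply, this, mul_smul]

/-- Multiplication by a complex number of modulus one as a linear isometry. -/
def circleSMul {E : Type*} [NormedAddCommGroup E] [NormedSpace ℂ E] :
    Circle →* (E ≃ₗᵢ[ℂ] E) where
  toFun z :=
    { LinearEquiv.smulOfNeZero ℂ E (z : ℂ) z.coe_ne_zero with
      norm_map' := fun x => by
        change ‖(z : ℂ) • x‖ = ‖x‖
        rw [norm_smul, Circle.norm_coe, one_mul] }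
  map_one' := by
    ext x
    change ((1 : Circle) : ℂ) • x = x
    simp
  map_mul' z z' := by
    ext x
    change ((z * z' : Circle) : ℂ) • x = (z : ℂ) • (z' : ℂ) • x
    rw [Circle.coe_mul, mul_smul]

theorem circleSMul_apply {E : Type*} [NormedAddCommGroup E] [NormedSpace ℂ E] (z : Circle)
    (x : E) : circleSMul z x = (z : ℂ) • x := rfl

variable {p} {α : IsoAction G A}

/-- The covariant representation `(π ∘ θ, χ V)`. -/
def CovRep.twist (ρ : CovRep.{u, v, w} p α) (χ : PontryaginDual G) (θ : A ≃ₗᵢ[ℂ] A)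
    (hmul : ∀ a b, θ (a * b) = θ a * θ b) (hθ : ∀ g a, θ (α g a) = α g (θ a)) :
    CovRep.{u, v, w} p α where
  X := ρ.X
  ν := ρ.ν
  π :=
    { toFun := fun a => ρ.π (θ a)
      map_smul' := fun c a => by simp
      map_zero' := by simp
      map_add' := fun a b => by simp
      map_mul' := fun a b => by simp [hmul] }
  contractive a := (ρ.contractive (θ a)).trans_eq (θ.norm_map a)
  nondegenerate := by
    rw [← ρ.nondegenerate]
    congr 2
    ext η
    constructor
    · rintro ⟨a, ξ, rfl⟩
      exact ⟨θ a, ξ, rfl⟩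
    · rintro ⟨a, ξ, rfl⟩
      exact ⟨θ.symm a, ξ, by simp⟩
  V :=
    { toFun := fun t => circleSMul (χ t) * ρ.V t
      map_one' := by simp
      map_mul' := fun s t => by
        ext1 ξ
        simp only [map_mul, LinearIsometryEquiv.coe_mul, Function.comp_apply, circleSMul_apply,
          map_smul] }
  continuous_V ξ :=
    (continuous_circle_coe.comp (map_continuous χ)).smul (ρ.continuous_V ξ)
  covariant t a ξ := by
    change (χ t : ℂ) • ρ.V t (ρ.π (θ a) ((χ t⁻¹ : ℂ) • ρ.V t⁻¹ ξ)) = ρ.π (θ (α t a)) ξ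
    rw [map_smul, map_smul, ρ.covariant, ← mul_smul, hθ, ← Circle.coe_mul, ← map_mul,
      mul_inv_cancel, map_one, Circle.coe_one, one_smul]

variable [IsTopologicalGroup G] [MeasurableSpace G] [BorelSpace G] {μ : Measure G}
  [μ.IsHaarMeasure]

theorem CovRep.integrated_twist (ρ : CovRep.{u, v, w} p α) (χ : PontryaginDual G)
    (θ : A ≃ₗᵢ[ℂ] A) (hmul : ∀ a b, θ (a * b) = θ a * θ b)
    (hθ : ∀ g a, θ (α g a) = α g (θ a)) (f : C_c(G, A)) :
    ρ.integrated μ (twistFn χ θ f) = (ρ.twist χ θ hmul hθ).integrated μ f := by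
  ext1 ξ
  change ∫ t, ρ.π ((χ t : ℂ) • θ (f t)) (ρ.V t ξ) ∂μ =
    ∫ t, ρ.π (θ (f t)) ((χ t : ℂ) • ρ.V t ξ) ∂μ
  simp only [map_smul, smul_apply]

/-- The twisting map on the convolution algebra. -/
def twistConv (χ : PontryaginDual G) (θ : A ≃ₗᵢ[ℂ] A) :
    ConvAlg.{u, v, w} p μ α ≃ₗ[ℂ] ConvAlg.{u, v, w} p μ α :=
  { (twistFn χ θ : C_c(G, A) →ₗ[ℂ] C_c(G, A)) with
    invFun := fun f => twistFn χ⁻¹ θ⁻¹ f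
    left_inv := fun f => (twistFn_mul _ _ _ _ f).symm.trans (by
      rw [inv_mul_cancel, inv_mul_cancel]
      exact twistFn_one f)
    right_inv := fun f => (twistFn_mul _ _ _ _ f).symm.trans (by
      rw [mul_inv_cancel, mul_inv_cancel]
      exact twistFn_one f) }

theorem toFn_twistConv (χ : PontryaginDual G) (θ : A ≃ₗᵢ[ℂ] A) (f : ConvAlg.{u, v, w} p μ α) :
    ConvAlg.toFn (twistConv χ θ f) = twistFn χ θ (ConvAlg.toFn f) := rfl

theorem norm_twistConv_le (χ : PontryaginDual G) (θ : A ≃ₗᵢ[ℂ] A)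
    (hmul : ∀ a b, θ (a * b) = θ a * θ b) (hθ : ∀ g a, θ (α g a) = α g (θ a))
    (f : ConvAlg.{u, v, w} p μ α) : ‖twistConv χ θ f‖ ≤ ‖f‖ := by
  refine Real.iSup_le (fun ρ => ?_) (norm_nonneg f)
  change ‖ρ.integrated μ (twistFn χ θ (ConvAlg.toFn f))‖ ≤ _
  rw [ρ.integrated_twist χ θ hmul hθ]
  exact ConvAlg.norm_integrated_le_norm _ f

theorem norm_twistConv (χ : PontryaginDual G) (θ : A ≃ₗᵢ[ℂ] A)
    (hmul : ∀ a b, θ (a * b) = θ a * θ b) (hθ : ∀ g a, θ (α g a) = α g (θ a))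
    (f : ConvAlg.{u, v, w} p μ α) : ‖twistConv χ θ f‖ = ‖f‖ := by
  refine le_antisymm (norm_twistConv_le χ θ hmul hθ f) ?_
  have h := norm_twistConv_le χ⁻¹ θ⁻¹ (α := α) (μ := μ) (p := p)
    (fun a b => θ.injective (by
      rw [hmul]
      change θ (θ.symm _) = θ (θ.symm _) * θ (θ.symm _)
      simp only [LinearIsometryEquiv.apply_symm_apply]))
    (fun g a => θ.injective (by
      rw [hθ]
      change θ (θ.symm _) = α g (θ (θ.symm _))
      simp only [LinearIsometryEquiv.apply_symm_apply])) (twistConv χ θ f)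
  exact (congrArg norm ((twistConv χ θ).symm_apply_apply f)).symm.le.trans h

theorem twistConv_mul_apply [IsScalarTower ℂ A A] [SMulCommClass ℂ A A] [CompleteSpace A]
    (χ : PontryaginDual G) (θ : A ≃ₗᵢ[ℂ] A)
    (hmul : ∀ a b, θ (a * b) = θ a * θ b) (hθ : ∀ g a, θ (α g a) = α g (θ a))
    (f g : ConvAlg.{u, v, w} p μ α) :
    twistConv χ θ (f * g) = twistConv χ θ f * twistConv χ θ g := by
  apply ConvAlg.toFn.injective
  ext t
  change (χ t : ℂ) • θ (∫ s, ConvAlg.toFn f s * α s (ConvAlg.toFn g (s⁻¹ * t)) ∂μ) =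
    ∫ s, ((χ s : ℂ) • θ (ConvAlg.toFn f s)) *
      α s ((χ (s⁻¹ * t) : ℂ) • θ (ConvAlg.toFn g (s⁻¹ * t))) ∂μ
  rw [← LinearIsometryEquiv.coe_toContinuousLinearEquiv, ← ContinuousLinearEquiv.integral_comp_comm,
    ← integral_smul]
  refine integral_congr_ae (Filter.Eventually.of_forall fun s => ?_)
  have h : (χ t : ℂ) = (χ s : ℂ) * (χ (s⁻¹ * t) : ℂ) := by
    rw [← Circle.coe_mul, ← map_mul, mul_inv_cancel_left]
  simp only [LinearIsometryEquiv.coe_toContinuousLinearEquiv, hmul, hθ, map_smul, h,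
    smul_mul_assoc, mul_smul_comm, mul_smul]
  exact smul_comm _ _ _

variable (p μ) in
/-- The extension of a twisting map to the crossed product. -/
def twistIso (χ : PontryaginDual G) (θ : A ≃ₗᵢ[ℂ] A)
    (hmul : ∀ a b, θ (a * b) = θ a * θ b) (hθ : ∀ g a, θ (α g a) = α g (θ a)) :
    LpCrossedProduct.{u, v, w} p μ α ≃ₗᵢ[ℂ] LpCrossedProduct.{u, v, w} p μ α :=
  LinearEquiv.extendOfIsometry (twistConv χ θ)
    (LpCrossedProduct.ofConv.{u, v, w} p μ α).toLinearMap
    (LpCrossedProduct.ofConv.{u, v, w} p μ α).toLinearMap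
    (LpCrossedProduct.denseRange_ofConv p μ α) (LpCrossedProduct.denseRange_ofConv p μ α)
    (fun f => by
      simp only [LinearIsometry.coe_toLinearMap, LinearIsometry.norm_map]
      exact norm_twistConv χ θ hmul hθ f)

theorem twistIso_ofConv (χ : PontryaginDual G) (θ : A ≃ₗᵢ[ℂ] A)
    (hmul : ∀ a b, θ (a * b) = θ a * θ b) (hθ : ∀ g a, θ (α g a) = α g (θ a))
    (f : ConvAlg.{u, v, w} p μ α) :
    twistIso p μ χ θ hmul hθ (LpCrossedProduct.ofConv p μ α f) =
      LpCrossedProduct.ofConv p μ α (twistConv χ θ f) :=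
  LinearEquiv.extendOfIsometry_eq _ (LpCrossedProduct.ofConv.{u, v, w} p μ α).toLinearMap
    (LpCrossedProduct.ofConv.{u, v, w} p μ α).toLinearMap _ _ _ f

variable [IsScalarTower ℂ A A] [SMulCommClass ℂ A A] [CompleteSpace A]
  {H : Type*} [Group H] [TopologicalSpace H]

theorem continuous_twistConv (θ : IsoAction H A) (χ : H →* PontryaginDual G)
    (hχ : Continuous fun q : H × G => χ q.1 q.2) (f : ConvAlg.{u, v, w} p μ α) :
    Continuous fun h => twistConv (χ h) (θ h) f := by
  rw [continuous_iff_continuousAt]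
  intro h₀
  rw [ContinuousAt, tendsto_iff_norm_sub_tendsto_zero]
  have h1 : Continuous fun q : H × G => twistFn (χ q.1) (θ q.1) (ConvAlg.toFn f) q.2 :=
    (continuous_circle_coe.comp hχ).smul
      (θ.joint.comp (continuous_fst.prodMk ((ConvAlg.toFn f).continuous.comp continuous_snd)))
  have h2 : Continuous fun h => ∫ s, ‖twistFn (χ h) (θ h) (ConvAlg.toFn f) s -
      twistFn (χ h₀) (θ h₀) (ConvAlg.toFn f) s‖ ∂μ := by
    rw [← continuousOn_univ]
    refine continuousOn_integral_of_compact_support (ConvAlg.toFn f).hasCompactSupport.isCompact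
      (h1.sub (h1.comp (continuous_const.prodMk continuous_snd))).norm.continuousOn
      fun h s _ hs => ?_
    simp [twistFn_apply, image_eq_zero_of_notMem_tsupport hs]
  have h3 := h2.tendsto h₀
  simp only [sub_self, norm_zero, integral_zero] at h3
  exact squeeze_zero (fun _ => norm_nonneg _) (fun h => ConvAlg.norm_le_integral _) h3

theorem twistIso_one {χ : PontryaginDual G} {θ : A ≃ₗᵢ[ℂ] A}
    (hmul : ∀ a b, θ (a * b) = θ a * θ b) (hθ : ∀ g a, θ (α g a) = α g (θ a))
    (h1 : χ = 1) (h2 : θ = 1) (x : LpCrossedProduct.{u, v, w} p μ α) :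
    twistIso p μ χ θ hmul hθ x = x := by
  refine (LpCrossedProduct.denseRange_ofConv p μ α).induction_on x
    (isClosed_eq (LinearIsometryEquiv.continuous _) continuous_id) fun f => ?_
  rw [twistIso_ofConv]
  refine congrArg (LpCrossedProduct.ofConv p μ α) (ConvAlg.toFn.injective ?_)
  rw [toFn_twistConv, h1, h2, twistFn_one]

theorem twistIso_comp {χ χ' χ'' : PontryaginDual G} {θ θ' θ'' : A ≃ₗᵢ[ℂ] A}
    (hmul : ∀ a b, θ (a * b) = θ a * θ b) (hθ : ∀ g a, θ (α g a) = α g (θ a))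
    (hmul' : ∀ a b, θ' (a * b) = θ' a * θ' b) (hθ' : ∀ g a, θ' (α g a) = α g (θ' a))
    (hmul'' : ∀ a b, θ'' (a * b) = θ'' a * θ'' b) (hθ'' : ∀ g a, θ'' (α g a) = α g (θ'' a))
    (h1 : χ'' = χ * χ') (h2 : θ'' = θ * θ') (x : LpCrossedProduct.{u, v, w} p μ α) :
    twistIso p μ χ'' θ'' hmul'' hθ'' x =
      twistIso p μ χ θ hmul hθ (twistIso p μ χ' θ' hmul' hθ' x) := by
  refine (LpCrossedProduct.denseRange_ofConv p μ α).induction_on x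
    (isClosed_eq (LinearIsometryEquiv.continuous _) ((LinearIsometryEquiv.continuous _).comp
      (LinearIsometryEquiv.continuous _))) fun f => ?_
  rw [twistIso_ofConv, twistIso_ofConv, twistIso_ofConv]
  refine congrArg (LpCrossedProduct.ofConv p μ α) (ConvAlg.toFn.injective ?_)
  rw [toFn_twistConv, toFn_twistConv, toFn_twistConv, h1, h2, twistFn_mul]

theorem twistIso_mul (χ : PontryaginDual G) (θ : A ≃ₗᵢ[ℂ] A)
    (hmul : ∀ a b, θ (a * b) = θ a * θ b) (hθ : ∀ g a, θ (α g a) = α g (θ a))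
    (x y : LpCrossedProduct.{u, v, w} p μ α) :
    twistIso p μ χ θ hmul hθ (x * y) =
      twistIso p μ χ θ hmul hθ x * twistIso p μ χ θ hmul hθ y := by
  have hc := (twistIso (α := α) p μ χ θ hmul hθ).continuous
  refine (LpCrossedProduct.denseRange_ofConv p μ α).induction_on₂
    (isClosed_eq (hc.comp (continuous_fst.mul continuous_snd))
      ((hc.comp continuous_fst).mul (hc.comp continuous_snd))) (fun f g => ?_) x y
  rw [← LpCrossedProduct.ofConv_mul, twistIso_ofConv, twistIso_ofConv, twistIso_ofConv,
    ← LpCrossedProduct.ofConv_mul, twistConv_mul_apply _ _ hmul hθ]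

theorem continuous_twistIso (θ : IsoAction H A) (hθ : ∀ h g a, θ h (α g a) = α g (θ h a))
    (χ : H →* PontryaginDual G) (hχ : Continuous fun q : H × G => χ q.1 q.2)
    (x : LpCrossedProduct.{u, v, w} p μ α) :
    Continuous fun h => twistIso p μ (χ h) (θ h) (θ.map_mul' h) (hθ h) x := by
  rw [Metric.continuous_iff']
  intro h₀ ε hε
  obtain ⟨f, hf⟩ := (LpCrossedProduct.denseRange_ofConv p μ α).exists_dist_lt x
    (ε := ε / 3) (by positivity)
  have hc : Continuous fun h => LpCrossedProduct.ofConv p μ α (twistConv (χ h) (θ h) f) :=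
    (LpCrossedProduct.ofConv p μ α).continuous.comp (continuous_twistConv θ χ hχ f)
  filter_upwards [Metric.continuous_iff'.1 hc h₀ (ε / 3) (by positivity)] with h hh
  rw [← twistIso_ofConv _ _ (θ.map_mul' h) (hθ h),
    ← twistIso_ofConv _ _ (θ.map_mul' h₀) (hθ h₀)] at hh
  refine (dist_triangle4 _
    (twistIso p μ (χ h) (θ h) (θ.map_mul' h) (hθ h) (LpCrossedProduct.ofConv p μ α f))
    (twistIso p μ (χ h₀) (θ h₀) (θ.map_mul' h₀) (hθ h₀) (LpCrossedProduct.ofConv p μ α f))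
    _).trans_lt ?_
  rw [LinearIsometryEquiv.dist_map, LinearIsometryEquiv.dist_map, dist_comm _ x]
  linarith

variable (p μ) in
/-- The action `h ↦ (f ↦ χ_h(·) θ_h(f(·)))` of a group `H` on `F^p(G, A, α)`, for an action `θ` of
`H` on `A` commuting with `α` and a continuous family `χ` of characters of `G`. -/
def twistAction (θ : IsoAction H A) (hθ : ∀ h g a, θ h (α g a) = α g (θ h a))
    (χ : H →* PontryaginDual G) (hχ : Continuous fun q : H × G => χ q.1 q.2) :
    IsoAction H (LpCrossedProduct.{u, v, w} p μ α) where
  toHom :=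
    { toFun := fun h => twistIso p μ (χ h) (θ h) (θ.map_mul' h) (hθ h)
      map_one' := LinearIsometryEquiv.ext fun x =>
        twistIso_one _ _ (map_one χ) (map_one θ.toHom) x
      map_mul' := fun h h' => LinearIsometryEquiv.ext fun x =>
        twistIso_comp _ _ _ _ _ _ (map_mul χ h h') (map_mul θ.toHom h h') x }
  map_mul' h x y := twistIso_mul _ _ (θ.map_mul' h) (hθ h) x y
  continuous' x := continuous_twistIso θ hθ χ hχ x

theorem twistAction_ofFn (θ : IsoAction H A) (hθ : ∀ h g a, θ h (α g a) = α g (θ h a))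
    (χ : H →* PontryaginDual G) (hχ : Continuous fun q : H × G => χ q.1 q.2) (h : H)
    (f : C_c(G, A)) :
    twistAction.{u, v, w} p μ θ hθ χ hχ h (LpCrossedProduct.ofFn p μ α f) =
      LpCrossedProduct.ofFn p μ α (twistFn (χ h) (θ h) f) :=
  twistIso_ofConv _ _ (θ.map_mul' h) (hθ h) _

end Twist

/-! ### Functions of two variables as elements of iterated crossed products -/

section Section

variable [IsTopologicalGroup G] [MeasurableSpace G] [BorelSpace G] (μ : Measure G)
  [μ.IsHaarMeasure] (α : IsoAction G A)
  {K : Type*} [Group K] [TopologicalSpace K] [IsTopologicalGroup K]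

/-- The function `F(k, ·)`. -/
def sectionFn (F : C_c(K × G, A)) (k : K) : C_c(G, A) where
  toFun s := F (k, s)
  continuous_toFun := F.continuous.comp (by fun_prop)
  hasCompactSupport' := HasCompactSupport.intro
    (F.hasCompactSupport.isCompact.image continuous_snd) fun s hs => by
      by_contra h
      exact hs ⟨(k, s), subset_tsupport _ h, rfl⟩

/-- The continuous compactly supported function `k ↦ F(k, ·)` from `K` to `F^p(G, A, α)`. -/
def sectionMap (F : C_c(K × G, A)) : C_c(K, LpCrossedProduct.{u, v, w} p μ α) where
  toFun k := LpCrossedProduct.ofFn p μ α (sectionFn F k)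
  continuous_toFun := by
    rw [continuous_iff_continuousAt]
    intro k₀
    rw [ContinuousAt, tendsto_iff_norm_sub_tendsto_zero]
    have h2 : Continuous fun k => ∫ s, ‖F (k, s) - F (k₀, s)‖ ∂μ := by
      rw [← continuousOn_univ]
      refine continuousOn_integral_of_compact_support
        (F.hasCompactSupport.isCompact.image continuous_snd)
        ((F.continuous.comp (by fun_prop : Continuous fun q : K × G => (q.1, q.2))).sub
          (F.continuous.comp (by fun_prop : Continuous fun q : K × G => (k₀, q.2)))
          ).norm.continuousOn fun k s _ hs => ?_
      have : ∀ k, F (k, s) = 0 := fun k => by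
        by_contra h
        exact hs ⟨(k, s), subset_tsupport _ h, rfl⟩
      simp [this]
    have h3 := h2.tendsto k₀
    simp only [sub_self, norm_zero, integral_zero] at h3
    refine squeeze_zero (fun _ => norm_nonneg _) (fun k => ?_) h3
    rw [LpCrossedProduct.ofFn, LpCrossedProduct.ofFn, ← map_sub, LinearIsometry.norm_map]
    exact ConvAlg.norm_le_integral _
  hasCompactSupport' := HasCompactSupport.intro
    (F.hasCompactSupport.isCompact.image continuous_fst) fun k hk => by
      have : sectionFn F k = 0 := by
        ext s
        by_contra h
        exact hk ⟨(k, s), subset_tsupport _ h, rfl⟩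
      rw [this, LpCrossedProduct.ofFn, map_zero, map_zero]

end Section
end Basic

/-! ### The dual action, the action `β̂ ⊗ α`, and the label change -/

section Dual

variable (p : ℝ≥0∞) [Fact (1 ≤ p)] {G : Type u} [CommGroup G] [TopologicalSpace G]
  [IsTopologicalGroup G] [LocallyCompactSpace G] [MeasurableSpace G]
  {A : Type v} [NonUnitalNormedRing A] [NormedSpace ℂ A] [IsScalarTower ℂ A A]
  [SMulCommClass ℂ A A] [CompleteSpace A]

theorem continuous_dual_apply : Continuous fun q : PontryaginDual G × G => q.1 q.2 :=
  (ContinuousMonoidHom.instContinuousEval (A := G) (B := Circle)).continuous_eval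

variable (G) in
/-- The canonical map of `G` to its double dual, `s ↦ (γ ↦ γ(s))`. -/
def evalHom : G →* PontryaginDual (PontryaginDual G) where
  toFun s :=
    ({ toFun := fun γ => γ s
       map_one' := rfl
       map_mul' := fun _ _ => rfl
       continuous_toFun := continuous_dual_apply.comp (continuous_id.prodMk continuous_const) } :
      PontryaginDual G →ₜ* Circle)
  map_one' := by
    ext γ
    exact congrArg _ (map_one γ)
  map_mul' s t := by
    ext γ
    exact congrArg _ (map_mul γ s t)

theorem evalHom_apply (s : G) (γ : PontryaginDual G) : evalHom G s γ = γ s := rfl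

theorem continuous_inv_apply :
    Continuous fun q : PontryaginDual G × G => (invMonoidHom q.1 : PontryaginDual G) q.2 :=
  (continuous_dual_apply (G := G)).inv

theorem continuous_evalHom_apply :
    Continuous fun q : G × PontryaginDual G => evalHom G q.1 q.2 :=
  (continuous_dual_apply (G := G)).comp continuous_swap

/-- The trivial action commutes with every action. -/
theorem trivial_comm {H K : Type*} [Group H] [TopologicalSpace H] [Group K] [TopologicalSpace K]
    (α : IsoAction K A) (h : H) (k : K) (a : A) :
    IsoAction.trivial H A h (α k a) = α k (IsoAction.trivial H A h a) := rfl

/-- The dual action `α̂` of `Ĝ` on `F^p(G, A, α)`, given by `α̂_γ(f)(s) = conj(γ(s)) f(s)` on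
`C_c(G, A, α)`. -/
def dualAction [BorelSpace G] (μ : Measure G) [μ.IsHaarMeasure] (α : IsoAction G A) :
    IsoAction (PontryaginDual G) (LpCrossedProduct.{u, v, w} p μ α) :=
  twistAction p μ (IsoAction.trivial (PontryaginDual G) A) (trivial_comm α) invMonoidHom
    continuous_inv_apply

theorem dualAction_ofFn [BorelSpace G] (μ : Measure G) [μ.IsHaarMeasure] (α : IsoAction G A)
    (γ : PontryaginDual G) (f g : C_c(G, A)) (h : ∀ s, g s = starRingEnd ℂ (γ s : ℂ) • f s) :
    dualAction.{u, v, w} p μ α γ (LpCrossedProduct.ofFn p μ α f) =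
      LpCrossedProduct.ofFn p μ α g := by
  rw [dualAction, twistAction_ofFn]
  congr 1
  ext s
  rw [h, ← Circle.coe_inv_eq_conj]
  rfl

/-- The action `β̂ ⊗ α` of `G` on `F^p(Ĝ, A, β)`, where `β` is the trivial action of `Ĝ` on `A`,
given by `(β̂ ⊗ α)_s(φ)(γ) = γ(s) α_s(φ(γ))` on `C_c(Ĝ, A, β)`. -/
def dualTensorAction [MeasurableSpace (PontryaginDual G)] [BorelSpace (PontryaginDual G)]
    (m : Measure (PontryaginDual G)) [m.IsHaarMeasure] (α : IsoAction G A) :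
    IsoAction G (LpCrossedProduct.{u, v, w} p m (IsoAction.trivial (PontryaginDual G) A)) :=
  twistAction p m α (fun s γ a => (trivial_comm α γ s a).symm) (evalHom G)
    continuous_evalHom_apply

theorem dualTensorAction_ofFn [MeasurableSpace (PontryaginDual G)]
    [BorelSpace (PontryaginDual G)] (m : Measure (PontryaginDual G)) [m.IsHaarMeasure]
    (α : IsoAction G A) (s : G) (f g : C_c(PontryaginDual G, A))
    (h : ∀ γ, g γ = (γ s : ℂ) • α s (f γ)) :
    dualTensorAction.{u, v, w} p m α s (LpCrossedProduct.ofFn p m _ f) =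
      LpCrossedProduct.ofFn p m _ g := by
  rw [dualTensorAction, twistAction_ofFn]
  congr 1
  ext γ
  rw [h]
  rfl

/-- The label change `Φ₁(F)(s, γ) = γ(s) F(γ, s)`. -/
def labelChange (F : C_c(PontryaginDual G × G, A)) : C_c(G × PontryaginDual G, A) where
  toFun q := (q.2 q.1 : ℂ) • F (q.2, q.1)
  continuous_toFun :=
    (continuous_circle_coe.comp (continuous_dual_apply.comp continuous_swap)).smul
      (F.continuous.comp continuous_swap)
  hasCompactSupport' :=
    (F.hasCompactSupport.comp_homeomorph (Homeomorph.prodComm G (PontryaginDual G))).smul_left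

theorem labelChange_apply (F : C_c(PontryaginDual G × G, A)) (s : G) (γ : PontryaginDual G) :
    labelChange F (s, γ) = (γ s : ℂ) • F (γ, s) := rfl

end Dual

section Discrete

variable {G : Type u} [Group G] [TopologicalSpace G] [DiscreteTopology G] [MeasurableSpace G]
  [BorelSpace G]

instance count_isHaarMeasure : (Measure.count : Measure G).IsHaarMeasure where
  lt_top_of_isCompact K hK := by
    rw [Measure.count_apply_finite K hK.finite_of_discrete]
    exact ENNReal.coe_lt_top
  open_pos U hU hne := by
    rw [Ne, Measure.count_eq_zero_iff]
    exact hne.ne_empty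

end Discrete

/-! ### `L^p` operator algebras and unique `L^p` operator matrix norms -/

section OperatorAlgebra

variable (p : ℝ≥0∞) [Fact (1 ≤ p)] (A : Type v) [NonUnitalNormedRing A] [NormedSpace ℂ A]

/-- `A` has an isometric representation on an `L^p` space. -/
def IsLpOperatorAlgebra : Prop :=
  ∃ (X : Type w) (_ : MeasurableSpace X) (ν : Measure X) (π : A →ₙₐ[ℂ] (Lp ℂ p ν →L[ℂ] Lp ℂ p ν)),
    ∀ a, ‖π a‖ = ‖a‖

variable {p} in
/-- The operator on the `n`-fold `ℓ^p` direct sum `E ⊕ ... ⊕ E` given by an `n × n` matrix of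
operators on `E`. For `E = L^p(X, ν)` this `ℓ^p` direct sum is `L^p({1, ..., n} × X)` with respect
to the product of counting measure and `ν`. -/
def matrixOperator {E : Type*} [NormedAddCommGroup E] [NormedSpace ℂ E] {n : ℕ}
    (T : Matrix (Fin n) (Fin n) (E →L[ℂ] E)) :
    PiLp p (fun _ : Fin n => E) →L[ℂ] PiLp p (fun _ : Fin n => E) :=
  (PiLp.continuousLinearEquiv p ℂ fun _ : Fin n => E).symm.toContinuousLinearMap ∘L
    (ContinuousLinearMap.pi fun i => ∑ j, T i j ∘L ContinuousLinearMap.proj j) ∘L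
    (PiLp.continuousLinearEquiv p ℂ fun _ : Fin n => E).toContinuousLinearMap

/-- `A` has unique `L^p` operator matrix norms: any two isometric representations of `A` on
separable `L^p` spaces of `σ`-finite measures induce the same norm on every matrix algebra
`M_n(A)`. -/
def HasUniqueLpMatrixNorms : Prop :=
  ∀ (X Y : Type w) (_ : MeasurableSpace X) (_ : MeasurableSpace Y) (ν : Measure X) (η : Measure Y),
    SigmaFinite ν → SigmaFinite η →
    TopologicalSpace.SeparableSpace (Lp ℂ p ν) → TopologicalSpace.SeparableSpace (Lp ℂ p η) →
    ∀ (π : A →ₙₐ[ℂ] (Lp ℂ p ν →L[ℂ] Lp ℂ p ν)) (σ : A →ₙₐ[ℂ] (Lp ℂ p η →L[ℂ] Lp ℂ p η)),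
      (∀ a, ‖π a‖ = ‖a‖) → (∀ a, ‖σ a‖ = ‖a‖) →
      ∀ (n : ℕ) (a : Matrix (Fin n) (Fin n) A),
        ‖matrixOperator (p := p) (a.map π)‖ = ‖matrixOperator (p := p) (a.map σ)‖

end OperatorAlgebra

end LpCrossed

end

/-!
The bump functions at the identity, multiplied by `1 : A`, form a contractive approximate unit of a
crossed product, so that its nondegenerate representations extend to multipliers, among them `A` and
the group. Hence a covariant representation of either iterated crossed product is given by a
representation of `A` together with covariant isometric representations `V` of `G` and `U` of the
dual group on the same `L^p` space, satisfying the Weyl relation `U_γ V_s = γ(s)⁻¹ V_s U_γ`. This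
description is symmetric in the two groups, and exchanging their roles carries the integrated form
of `F` to that of its label change: by the Weyl relation and Fubini's theorem,
`∫∫ π(F(γ, s)) V_s U_γ ds dγ = ∫∫ γ(s) π(F(γ, s)) U_γ V_s dγ ds`. So the label change preserves the
norms. Its extension preserves the products because the integrated forms are multiplicative and
separate the points of a crossed product, and it is unique because the functions of two variables
are dense.
-/

noncomputable section

namespace LpCrossed

/-! ### Nondegenerate representations and multipliers -/

section Family

variable {𝕜 E F : Type*} [NontriviallyNormedField 𝕜] [SeminormedAddCommGroup E] [NormedSpace 𝕜 E]
  [SeminormedAddCommGroup F] [NormedSpace 𝕜 F]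

theorem continuous_apply_of_dense_span {T : Type*} [TopologicalSpace T] {V : T → E →L[𝕜] F} {C : ℝ}
    (hV : ∀ t, ‖V t‖ ≤ C) {S : Set E} (hS : Dense (Submodule.span 𝕜 S : Set E))
    (hSV : ∀ x ∈ S, Continuous fun t => V t x) (x : E) : Continuous fun t => V t x := by
  have hspan : ∀ y ∈ Submodule.span 𝕜 S, Continuous fun t => V t y := fun y hy => by
    induction hy using Submodule.span_induction with
    | mem y hy => exact hSV y hy
    | zero => simpa only [map_zero] using continuous_const
    | add y z _ _ hy hz => simp only [map_add]; exact hy.add hz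
    | smul c y _ hy => simp only [map_smul]; exact hy.const_smul c
  refine continuous_of_uniform_approx_of_continuous fun u hu => ?_
  obtain ⟨ε, hε, hεu⟩ := Metric.mem_uniformity_dist.1 hu
  have hC : 0 < |C| + 1 := by positivity
  obtain ⟨y, hxy, hy⟩ := Metric.dense_iff.1 hS x (ε / (|C| + 1)) (by positivity)
  refine ⟨fun t => V t y, hspan y hy, fun t => hεu ?_⟩
  rw [mem_ball_iff_norm', lt_div_iff₀' hC] at hxy
  rw [dist_eq_norm, ← map_sub]
  refine ((V t).le_of_opNorm_le ((hV t).trans ?_) _).trans_lt hxy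
  linarith [le_abs_self C]

/-- The isometric representation underlying a representation of a group by contractions. -/
def isometryHom {Γ : Type*} [Group Γ] (u : Γ →* (E →L[𝕜] E)) (hu : ∀ s, ‖u s‖ ≤ 1) :
    Γ →* (E ≃ₗᵢ[𝕜] E) :=
  have apply_inv (s : Γ) (x : E) : u s (u s⁻¹ x) = x := by
    rw [← mul_apply_eq_comp, ← map_mul, mul_inv_cancel, map_one, one_apply_eq_self]
  have inv_apply (s : Γ) (x : E) : u s⁻¹ (u s x) = x := by
    simpa only [inv_inv] using apply_inv s⁻¹ x
  have contractive (s : Γ) (x : E) : ‖u s x‖ ≤ ‖x‖ := by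
    simpa only [one_mul] using (u s).le_of_opNorm_le (hu s) x
  { toFun := fun s =>
      { toLinearEquiv := LinearEquiv.ofLinearMap (u s : E →ₗ[𝕜] E) (u s⁻¹ : E →ₗ[𝕜] E)
          (LinearMap.ext (apply_inv s)) (LinearMap.ext (inv_apply s))
        norm_map' := fun x => (contractive s x).antisymm <| by
          simpa only [inv_apply] using contractive s⁻¹ (u s x) }
    map_one' := LinearIsometryEquiv.ext fun x => DFunLike.congr_fun (map_one u) x
    map_mul' := fun s t => LinearIsometryEquiv.ext fun x => DFunLike.congr_fun (map_mul u s t) x }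

end Family

section Multiplier

variable {𝕜 B E F : Type*} [NontriviallyNormedField 𝕜] [NonUnitalSeminormedRing B]
  [NormedSpace 𝕜 B] [NormedAddCommGroup E] [NormedSpace 𝕜 E]

/-- A contractive representation whose range spans a dense subspace. -/
structure IsNondegenerateRep (σ : B →ₙₐ[𝕜] (E →L[𝕜] E)) : Prop where
  norm_le : ∀ b, ‖σ b‖ ≤ ‖b‖
  topologicalClosure_span : (Submodule.span 𝕜 {η | ∃ b ξ, η = σ b ξ}).topologicalClosure = ⊤

namespace IsNondegenerateRep

variable {σ : B →ₙₐ[𝕜] (E →L[𝕜] E)}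

theorem dense_span (hσ : IsNondegenerateRep σ) :
    Dense (Submodule.span 𝕜 {η | ∃ b ξ, η = σ b ξ} : Set E) :=
  Submodule.dense_iff_topologicalClosure_eq_top.2 hσ.topologicalClosure_span

theorem ext (hσ : IsNondegenerateRep σ) [NormedAddCommGroup F] [NormedSpace 𝕜 F]
    {S T : E →L[𝕜] F} (h : ∀ b ξ, S (σ b ξ) = T (σ b ξ)) : S = T :=
  ContinuousLinearMap.ext_on hσ.dense_span <| by
    rintro _ ⟨b, ξ, rfl⟩
    exact h b ξ

theorem continuous (hσ : IsNondegenerateRep σ) : Continuous σ :=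
  AddMonoidHomClass.continuous_of_bound σ 1 fun b => by simpa only [one_mul] using hσ.norm_le b

theorem continuous_apply (hσ : IsNondegenerateRep σ) (ξ : E) :
    Continuous fun b => σ b ξ :=
  hσ.continuous.clm_apply continuous_const

end IsNondegenerateRep

/-- The linear map `b ⊗ ξ ↦ σ b ξ`. -/
def actionMap (σ : B →ₙₐ[𝕜] (E →L[𝕜] E)) : TensorProduct 𝕜 B E →ₗ[𝕜] E :=
  TensorProduct.lift (ContinuousLinearMap.coeLM 𝕜 ∘ₗ (σ : B →ₗ[𝕜] (E →L[𝕜] E)))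

@[simp] theorem actionMap_tmul (σ : B →ₙₐ[𝕜] (E →L[𝕜] E)) (b : B) (ξ : E) :
    actionMap σ (b ⊗ₜ ξ) = σ b ξ := rfl

theorem IsNondegenerateRep.denseRange_actionMap {σ : B →ₙₐ[𝕜] (E →L[𝕜] E)}
    (hσ : IsNondegenerateRep σ) : DenseRange (actionMap σ) := by
  refine hσ.dense_span.mono (Submodule.span_le.2 ?_ : _ ≤ LinearMap.range (actionMap σ))
  rintro _ ⟨b, ξ, rfl⟩
  exact ⟨b ⊗ₜ ξ, actionMap_tmul σ b ξ⟩

variable (B) in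
/-- The existence of a left approximate unit in the closed unit ball, given as a filter. -/
def HasContractiveLeftApproxUnit : Prop :=
  ∃ l : Filter B, l.NeBot ∧ (∀ᶠ e in l, ‖e‖ ≤ 1) ∧ ∀ b, Filter.Tendsto (· * b) l (𝓝 b)

variable [IsScalarTower 𝕜 B B]

variable (𝕜 B) in
/-- The algebra of bounded left multipliers of `B`: the bounded operators on `B` that commute with
all right multiplications. -/
def leftMultiplier : Subalgebra 𝕜 (B →L[𝕜] B) where
  carrier := {L | ∀ b c, L (b * c) = L b * c}
  mul_mem' hL hM b c := by
    simp only [mul_apply_eq_comp, hM b c, hL _ c]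
  add_mem' hL hM b c := by
    simp only [add_apply, hL b c, hM b c, add_mul]
  algebraMap_mem' k b c := by
    simp only [Algebra.algebraMap_eq_smul_one, smul_apply, one_apply_eq_self, smul_mul_assoc]

namespace IsNondegenerateRep

open scoped TensorProduct

variable {σ : B →ₙₐ[𝕜] (E →L[𝕜] E)}

theorem tendsto_apply_actionMap (hσ : IsNondegenerateRep σ) {l : Filter B}
    (hl : ∀ b, Filter.Tendsto (· * b) l (𝓝 b)) (L : leftMultiplier 𝕜 B) (z : B ⊗[𝕜] E) :
    Filter.Tendsto (fun e => σ (L.1 e) (actionMap σ z)) l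
      (𝓝 (actionMap σ ((L.1 : B →ₗ[𝕜] B).rTensor E z))) := by
  induction z using TensorProduct.induction_on with
  | zero => simpa only [map_zero] using tendsto_const_nhds
  | tmul b ξ =>
    have h : Continuous fun b => σ (L.1 b) ξ := (hσ.continuous_apply ξ).comp L.1.continuous
    simpa only [actionMap_tmul, LinearMap.rTensor_tmul, ContinuousLinearMap.coe_coe,
      Function.comp_def, L.2 _ _, map_mul, mul_apply_eq_comp] using
      (h.tendsto b).comp (hl b)
  | add x y hx hy => simpa only [map_add] using hx.add hy

theorem norm_actionMap_rTensor_le (hσ : IsNondegenerateRep σ)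
    (hB : HasContractiveLeftApproxUnit B) (L : leftMultiplier 𝕜 B) (z : B ⊗[𝕜] E) :
    ‖actionMap σ ((L.1 : B →ₗ[𝕜] B).rTensor E z)‖ ≤ ‖L.1‖ * ‖actionMap σ z‖ := by
  obtain ⟨l, hl, hl1, hlb⟩ := hB
  refine le_of_tendsto (hσ.tendsto_apply_actionMap hlb L z).norm ?_
  filter_upwards [hl1] with e he
  refine (σ (L.1 e)).le_of_opNorm_le ((hσ.norm_le _).trans ?_) _
  exact (L.1.le_opNorm e).trans (mul_le_of_le_one_right (norm_nonneg L.1) he)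

end IsNondegenerateRep

variable [CompleteSpace E]

/-- The operator `σ b ξ ↦ σ (L b) ξ` induced by a left multiplier `L`. -/
def extendMultiplier (σ : B →ₙₐ[𝕜] (E →L[𝕜] E)) (L : leftMultiplier 𝕜 B) : E →L[𝕜] E :=
  LinearMap.extendOfNorm (actionMap σ ∘ₗ (L.1 : B →ₗ[𝕜] B).rTensor E) (actionMap σ)

namespace IsNondegenerateRep

variable {σ : B →ₙₐ[𝕜] (E →L[𝕜] E)}

theorem extendMultiplier_apply (hσ : IsNondegenerateRep σ)
    (hB : HasContractiveLeftApproxUnit B) (L : leftMultiplier 𝕜 B) (b : B) (ξ : E) :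
    extendMultiplier σ L (σ b ξ) = σ (L.1 b) ξ :=
  LinearMap.extendOfNorm_eq hσ.denseRange_actionMap
    ⟨‖L.1‖, hσ.norm_actionMap_rTensor_le hB L⟩ (b ⊗ₜ ξ)

theorem norm_extendMultiplier_le (hσ : IsNondegenerateRep σ)
    (hB : HasContractiveLeftApproxUnit B) (L : leftMultiplier 𝕜 B) :
    ‖extendMultiplier σ L‖ ≤ ‖L.1‖ :=
  LinearMap.opNorm_extendOfNorm_le hσ.denseRange_actionMap (norm_nonneg L.1)
    (hσ.norm_actionMap_rTensor_le hB L)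

variable (hσ : IsNondegenerateRep σ) (hB : HasContractiveLeftApproxUnit B)

/-- The extension of a nondegenerate representation to the left multiplier algebra. -/
def multiplierRep : leftMultiplier 𝕜 B →ₐ[𝕜] (E →L[𝕜] E) :=
  AlgHom.ofLinearMap
    { toFun := extendMultiplier σ
      map_add' := fun L M => hσ.ext fun b ξ => by
        simp only [hσ.extendMultiplier_apply hB, Subalgebra.coe_add, add_apply, map_add]
      map_smul' := fun c L => hσ.ext fun b ξ => by
        simp only [hσ.extendMultiplier_apply hB, Subalgebra.coe_smul,
          smul_apply, map_smul, RingHom.id_apply] }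
    (hσ.ext fun b ξ => hσ.extendMultiplier_apply hB 1 b ξ)
    (fun L M => hσ.ext fun b ξ => by
      simp only [LinearMap.coe_mk, AddHom.coe_mk, mul_apply_eq_comp,
        hσ.extendMultiplier_apply hB, Subalgebra.coe_mul])

theorem multiplierRep_apply (L : leftMultiplier 𝕜 B) (b : B) (ξ : E) :
    hσ.multiplierRep hB L (σ b ξ) = σ (L.1 b) ξ :=
  hσ.extendMultiplier_apply hB L b ξ

theorem norm_multiplierRep_le (L : leftMultiplier 𝕜 B) :
    ‖hσ.multiplierRep hB L‖ ≤ ‖L.1‖ :=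
  hσ.norm_extendMultiplier_le hB L

end IsNondegenerateRep

end Multiplier

/-! ### Representations of the crossed product -/

section IntegratedForm

variable {p : ℝ≥0∞} [Fact (1 ≤ p)] {G : Type u} [Group G] [TopologicalSpace G]

theorem CovRep.isNondegenerateRep {A : Type v} [NonUnitalNormedRing A] [NormedSpace ℂ A]
    {α : IsoAction G A} (ρ : CovRep.{u, v, w} p α) : IsNondegenerateRep ρ.π :=
  ⟨ρ.contractive, ρ.nondegenerate⟩

variable [IsTopologicalGroup G] [MeasurableSpace G] [BorelSpace G]
  {A : Type v} [NonUnitalNormedRing A] [NormedSpace ℂ A] [IsScalarTower ℂ A A]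
  [SMulCommClass ℂ A A] [CompleteSpace A]
  {μ : Measure G} [μ.IsHaarMeasure] {α : IsoAction G A}

namespace LpCrossedProduct

variable (p μ α) in
/-- The map `ofFn` as a linear map. -/
def ofFnₗ : C_c(G, A) →ₗ[ℂ] LpCrossedProduct.{u, v, w} p μ α :=
  (ofConv.{u, v, w} p μ α).toLinearMap ∘ₗ ConvAlg.toFn.symm.toLinearMap

@[simp] theorem ofFnₗ_apply (f : C_c(G, A)) :
    ofFnₗ.{u, v, w} p μ α f = ofFn.{u, v, w} p μ α f := rfl

variable (p μ α) in
theorem denseRange_ofFn : DenseRange (ofFn.{u, v, w} p μ α) :=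
  (denseRange_ofConv.{u, v, w} p μ α).comp ConvAlg.toFn.symm.surjective.denseRange
    (ofConv.{u, v, w} p μ α).continuous

theorem ofFn_conv (f g : C_c(G, A)) :
    ofFn.{u, v, w} p μ α (ConvAlg.conv μ α f g) = ofFn p μ α f * ofFn p μ α g :=
  ofConv_mul _ _

theorem norm_ofFn_le_integral (f : C_c(G, A)) :
    ‖ofFn.{u, v, w} p μ α f‖ ≤ ∫ t, ‖f t‖ ∂μ := by
  rw [ofFn, LinearIsometry.norm_map]
  exact ConvAlg.norm_le_integral _

theorem norm_ofFn_le {f : C_c(G, A)} {C : ℝ} (hC : 0 ≤ C)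
    (h : ∀ ρ : CovRep.{u, v, w} p α, ‖ρ.integrated μ f‖ ≤ C) :
    ‖ofFn.{u, v, w} p μ α f‖ ≤ C := by
  rw [ofFn, LinearIsometry.norm_map]
  exact Real.iSup_le h hC

end LpCrossedProduct

open LpCrossedProduct

namespace CovRep

variable (ρ : CovRep.{u, v, w} p α)

theorem norm_integrated_le_norm_ofFn (f : C_c(G, A)) :
    ‖ρ.integrated μ f‖ ≤ ‖ofFn.{u, v, w} p μ α f‖ := by
  rw [ofFn, LinearIsometry.norm_map]
  exact ConvAlg.norm_integrated_le_norm ρ _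

variable (μ) in
/-- The integrated form as a linear map. -/
def integratedₗ : C_c(G, A) →ₗ[ℂ] (ρ.E →L[ℂ] ρ.E) where
  toFun := ρ.integrated μ
  map_add' := ρ.integrated_add μ
  map_smul' := ρ.integrated_smul μ

variable (μ) in
/-- The extension of the integrated form to the crossed product, as a bounded linear map. -/
def integratedL : LpCrossedProduct.{u, v, w} p μ α →L[ℂ] (ρ.E →L[ℂ] ρ.E) :=
  LinearMap.extendOfNorm (ρ.integratedₗ μ) (ofFnₗ.{u, v, w} p μ α)

theorem norm_integratedₗ_le (f : C_c(G, A)) :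
    ‖ρ.integratedₗ μ f‖ ≤ 1 * ‖ofFnₗ.{u, v, w} p μ α f‖ := by
  rw [one_mul]
  exact ρ.norm_integrated_le_norm_ofFn f

@[simp] theorem integratedL_ofFn (f : C_c(G, A)) :
    ρ.integratedL μ (ofFn p μ α f) = ρ.integrated μ f :=
  LinearMap.extendOfNorm_eq (e := ofFnₗ.{u, v, w} p μ α) (denseRange_ofFn p μ α)
    ⟨1, ρ.norm_integratedₗ_le⟩ f

theorem norm_integratedL_le (x : LpCrossedProduct.{u, v, w} p μ α) :
    ‖ρ.integratedL μ x‖ ≤ ‖x‖ :=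
  (LinearMap.norm_extendOfNorm_apply_le (e := ofFnₗ.{u, v, w} p μ α) (denseRange_ofFn p μ α) 1
    ρ.norm_integratedₗ_le x).trans_eq (one_mul _)

theorem continuous_integratedL_apply (ξ : ρ.E) :
    Continuous fun x : LpCrossedProduct.{u, v, w} p μ α => ρ.integratedL μ x ξ :=
  (ρ.integratedL μ).continuous.clm_apply continuous_const

theorem integratedL_mul (x y : LpCrossedProduct.{u, v, w} p μ α) :
    ρ.integratedL μ (x * y) = ρ.integratedL μ x * ρ.integratedL μ y := by
  have hc := (ρ.integratedL μ).continuous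
  refine (denseRange_ofFn p μ α).induction_on₂
    (isClosed_eq (hc.comp (continuous_fst.mul continuous_snd))
      ((hc.comp continuous_fst).mul (hc.comp continuous_snd))) (fun f g => ?_) x y
  rw [← ofFn_conv, integratedL_ofFn, integratedL_ofFn, integratedL_ofFn,
    ConvAlg.integrated_conv]

variable (μ) in
/-- The representation of the crossed product given by a covariant representation. -/
def integratedHom : LpCrossedProduct.{u, v, w} p μ α →ₙₐ[ℂ] (ρ.E →L[ℂ] ρ.E) where
  toFun := ρ.integratedL μ
  map_smul' c x := map_smul (ρ.integratedL μ) c x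
  map_zero' := map_zero (ρ.integratedL μ)
  map_add' := map_add (ρ.integratedL μ)
  map_mul' := ρ.integratedL_mul

@[simp] theorem integratedHom_apply (x : LpCrossedProduct.{u, v, w} p μ α) :
    ρ.integratedHom μ x = ρ.integratedL μ x := rfl

end CovRep

namespace LpCrossedProduct

theorem norm_le_of_forall_integratedL {x : LpCrossedProduct.{u, v, w} p μ α} {C : ℝ}
    (hC : 0 ≤ C) (h : ∀ ρ : CovRep.{u, v, w} p α, ‖ρ.integratedL μ x‖ ≤ C) : ‖x‖ ≤ C := by
  refine le_of_forall_pos_le_add fun ε hε => ?_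
  obtain ⟨f, hf⟩ := (denseRange_ofFn p μ α).exists_dist_lt x (ε := ε / 2) (by positivity)
  rw [dist_eq_norm] at hf
  have norm_f_le : ‖ofFn p μ α f‖ ≤ C + ε / 2 := norm_ofFn_le (by positivity) fun ρ => by
    rw [← ρ.integratedL_ofFn]
    refine (norm_le_norm_add_norm_sub (ρ.integratedL μ x) _).trans (add_le_add (h ρ) ?_)
    rw [← map_sub]
    exact (ρ.norm_integratedL_le _).trans hf.le
  linarith [norm_le_norm_add_norm_sub' x (ofFn p μ α f)]

theorem ext_integratedL {x y : LpCrossedProduct.{u, v, w} p μ α}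
    (h : ∀ (ρ : CovRep.{u, v, w} p α) (ξ : ρ.E), ρ.integratedL μ x ξ = ρ.integratedL μ y ξ) :
    x = y := by
  rw [← sub_eq_zero, ← norm_le_zero_iff]
  refine norm_le_of_forall_integratedL le_rfl fun ρ => ?_
  rw [map_sub, ContinuousLinearMap.ext (h ρ), sub_self, norm_zero]

end LpCrossedProduct

end IntegratedForm

section MulShift

open LpCrossedProduct

section Action

variable {G : Type u} [Group G] [TopologicalSpace G]
  {A : Type v} [NormedRing A] [NormedAlgebra ℂ A] {α : IsoAction G A}

theorem IsoAction.apply_one (α : IsoAction G A) (s : G) : α s 1 = 1 := by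
  have h := α.map_mul' s 1 ((α s).symm 1)
  rwa [LinearIsometryEquiv.apply_symm_apply, one_mul, LinearIsometryEquiv.apply_symm_apply,
    mul_one, eq_comm] at h

theorem CovRep.π_one {p : ℝ≥0∞} [Fact (1 ≤ p)] (ρ : CovRep.{u, v, w} p α) : ρ.π 1 = 1 :=
  ρ.isNondegenerateRep.ext fun a ξ => by
    rw [← mul_apply_eq_comp, ← map_mul, one_mul, one_apply_eq_self]

variable [IsTopologicalGroup G]

variable (α) in
/-- The function `t ↦ a α_s(f(s⁻¹ t))`. -/
def mulShiftFn (a : A) (s : G) : C_c(G, A) →ₗ[ℂ] C_c(G, A) where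
  toFun f :=
    { toFun := fun t => a * α s (f (s⁻¹ * t))
      continuous_toFun := continuous_const.mul
        ((α s).continuous.comp (f.continuous.comp (continuous_const_mul _)))
      hasCompactSupport' :=
        (f.hasCompactSupport.comp_homeomorph (Homeomorph.mulLeft s⁻¹)).comp_left
          (g := fun b => a * α s b) (by rw [map_zero, mul_zero]) }
  map_add' f g := by
    ext t
    exact (congrArg (a * ·) (map_add (α s) _ _)).trans (mul_add _ _ _)
  map_smul' c f := by
    ext t
    exact (congrArg (a * ·) (map_smul (α s) c _)).trans (mul_smul_comm c _ _)

theorem mulShiftFn_apply (a : A) (s : G) (f : C_c(G, A)) (t : G) :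
    mulShiftFn α a s f t = a * α s (f (s⁻¹ * t)) := rfl

end Action

variable {p : ℝ≥0∞} [Fact (1 ≤ p)] {G : Type u} [Group G] [TopologicalSpace G]
  [IsTopologicalGroup G] [MeasurableSpace G] [BorelSpace G] {A : Type v} [NormedRing A]
  [NormedAlgebra ℂ A] {μ : Measure G} [μ.IsHaarMeasure] {α : IsoAction G A}

theorem CovRep.integrated_mulShiftFn (ρ : CovRep.{u, v, w} p α) (a : A) (s : G) (f : C_c(G, A))
    (ξ : ρ.E) : ρ.integrated μ (mulShiftFn α a s f) ξ = ρ.π a (ρ.V s (ρ.integrated μ f ξ)) := by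
  have h := ((ρ.π a).comp
      (ρ.V s).toContinuousLinearEquiv.toContinuousLinearMap).integral_comp_comm
      (ρ.integrable_integrand μ f ξ)
  refine Eq.trans ?_ h
  rw [ρ.integrated_apply, ← integral_mul_left_eq_self _ s]
  refine integral_congr_ae (Filter.Eventually.of_forall fun t => ?_)
  simp only [mulShiftFn_apply, inv_mul_cancel_left, map_mul, mul_apply_eq_comp, ← ρ.V_π,
    ContinuousLinearMap.comp_apply, LinearIsometryEquiv.coe_mul, Function.comp_apply]
  rfl

theorem CovRep.norm_integrated_mulShiftFn_le (ρ : CovRep.{u, v, w} p α) (a : A) (s : G)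
    (f : C_c(G, A)) :
    ‖ρ.integrated μ (mulShiftFn α a s f)‖ ≤ ‖ρ.π a‖ * ‖ρ.integrated μ f‖ := by
  refine ContinuousLinearMap.opNorm_le_bound _ (by positivity) fun ξ => ?_
  rw [ρ.integrated_mulShiftFn, mul_assoc]
  refine (ρ.π a).le_opNorm_of_le ?_
  rw [LinearIsometryEquiv.norm_map]
  exact (ρ.integrated μ f).le_opNorm ξ

variable [CompleteSpace A]

namespace LpCrossedProduct

theorem norm_ofFn_mulShiftFn_le {a : A} {C : ℝ} (hC : 0 ≤ C)
    (ha : ∀ ρ : CovRep.{u, v, w} p α, ‖ρ.π a‖ ≤ C) (s : G) (f : C_c(G, A)) :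
    ‖ofFn.{u, v, w} p μ α (mulShiftFn α a s f)‖ ≤ C * ‖ofFn.{u, v, w} p μ α f‖ :=
  norm_ofFn_le (by positivity) fun ρ => (ρ.norm_integrated_mulShiftFn_le a s f).trans <|
    mul_le_mul (ha ρ) (ρ.norm_integrated_le_norm_ofFn f) (norm_nonneg _) hC

variable (p μ α) in
/-- The left multiplier of the crossed product that extends `f ↦ (t ↦ a α_s(f(s⁻¹ t)))`. -/
def mulShift (a : A) (s : G) :
    LpCrossedProduct.{u, v, w} p μ α →L[ℂ] LpCrossedProduct.{u, v, w} p μ α :=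
  LinearMap.extendOfNorm (ofFnₗ.{u, v, w} p μ α ∘ₗ mulShiftFn α a s) (ofFnₗ.{u, v, w} p μ α)

theorem mulShift_ofFn (a : A) (s : G) (f : C_c(G, A)) :
    mulShift.{u, v, w} p μ α a s (ofFn p μ α f) = ofFn p μ α (mulShiftFn α a s f) :=
  LinearMap.extendOfNorm_eq (e := ofFnₗ.{u, v, w} p μ α) (denseRange_ofFn p μ α)
    ⟨‖a‖, norm_ofFn_mulShiftFn_le (norm_nonneg a) (fun ρ => ρ.contractive a) s⟩ f

theorem norm_mulShift_le_of_forall {a : A} {C : ℝ} (hC : 0 ≤ C)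
    (ha : ∀ ρ : CovRep.{u, v, w} p α, ‖ρ.π a‖ ≤ C) (s : G) :
    ‖mulShift.{u, v, w} p μ α a s‖ ≤ C :=
  LinearMap.opNorm_extendOfNorm_le (e := ofFnₗ.{u, v, w} p μ α) (denseRange_ofFn p μ α) hC
    (norm_ofFn_mulShiftFn_le hC ha s)

theorem norm_mulShift_le (a : A) (s : G) : ‖mulShift.{u, v, w} p μ α a s‖ ≤ ‖a‖ :=
  norm_mulShift_le_of_forall (norm_nonneg a) (fun ρ => ρ.contractive a) s

theorem norm_mulShift_one_le (s : G) : ‖mulShift.{u, v, w} p μ α 1 s‖ ≤ 1 :=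
  norm_mulShift_le_of_forall zero_le_one
    (fun ρ => ρ.π_one ▸ ContinuousLinearMap.norm_id_le) s

end LpCrossedProduct

theorem CovRep.integratedL_mulShift (ρ : CovRep.{u, v, w} p α) (a : A) (s : G)
    (x : LpCrossedProduct.{u, v, w} p μ α) (ξ : ρ.E) :
    ρ.integratedL μ (mulShift p μ α a s x) ξ = ρ.π a (ρ.V s (ρ.integratedL μ x ξ)) := by
  have hx := ρ.continuous_integratedL_apply (μ := μ) ξ
  refine (denseRange_ofFn p μ α).induction_on x
    (isClosed_eq (hx.comp (mulShift p μ α a s).continuous)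
      ((ρ.π a).continuous.comp ((ρ.V s).continuous.comp hx))) fun f => ?_
  rw [mulShift_ofFn, ρ.integratedL_ofFn, ρ.integratedL_ofFn, ρ.integrated_mulShiftFn]

namespace LpCrossedProduct

theorem mulShift_mul (a : A) (s : G) (x y : LpCrossedProduct.{u, v, w} p μ α) :
    mulShift p μ α a s (x * y) = mulShift p μ α a s x * y :=
  ext_integratedL fun ρ ξ => by
    simp only [ρ.integratedL_mulShift, ρ.integratedL_mul, mul_apply_eq_comp]

variable (p μ α) in
/-- The elements of `A` as left multipliers of the crossed product. -/
def coeffMultiplier : A →ₐ[ℂ] leftMultiplier ℂ (LpCrossedProduct.{u, v, w} p μ α) :=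
  AlgHom.ofLinearMap
    { toFun := fun a => ⟨mulShift p μ α a 1, mulShift_mul a 1⟩
      map_add' := fun a b => Subtype.ext <| ContinuousLinearMap.ext fun x =>
        ext_integratedL fun ρ ξ => by
          simp only [Subalgebra.coe_add, map_add, add_apply, ρ.integratedL_mulShift]
      map_smul' := fun c a => Subtype.ext <| ContinuousLinearMap.ext fun x =>
        ext_integratedL fun ρ ξ => by
          simp only [Subalgebra.coe_smul, map_smul, smul_apply, ρ.integratedL_mulShift,
            RingHom.id_apply] }
    (Subtype.ext <| ContinuousLinearMap.ext fun x => ext_integratedL fun ρ ξ => by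
      simp [ρ.integratedL_mulShift, ρ.π_one])
    (fun a b => Subtype.ext <| ContinuousLinearMap.ext fun x => ext_integratedL fun ρ ξ => by
      simp [ρ.integratedL_mulShift])

variable (p μ α) in
/-- The elements of `G` as left multipliers of the crossed product. -/
def shiftMultiplier : G →* leftMultiplier ℂ (LpCrossedProduct.{u, v, w} p μ α) where
  toFun s := ⟨mulShift p μ α 1 s, mulShift_mul 1 s⟩
  map_one' := Subtype.ext <| ContinuousLinearMap.ext fun x => ext_integratedL fun ρ ξ => by
    simp [ρ.integratedL_mulShift, ρ.π_one]
  map_mul' s t := Subtype.ext <| ContinuousLinearMap.ext fun x => ext_integratedL fun ρ ξ => by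
    simp [ρ.integratedL_mulShift, ρ.π_one]

@[simp] theorem coe_coeffMultiplier (a : A) :
    (coeffMultiplier.{u, v, w} p μ α a).1 = mulShift p μ α a 1 := rfl

@[simp] theorem coe_shiftMultiplier (s : G) :
    (shiftMultiplier.{u, v, w} p μ α s).1 = mulShift p μ α 1 s := rfl

theorem mulShift_one_mulShift_one (a : A) (s : G) (x : LpCrossedProduct.{u, v, w} p μ α) :
    mulShift p μ α a 1 (mulShift p μ α 1 s x) = mulShift p μ α a s x :=
  ext_integratedL fun ρ ξ => by simp [ρ.integratedL_mulShift, ρ.π_one]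

theorem shiftMultiplier_mul_coeffMultiplier (a : A) (s : G) :
    shiftMultiplier.{u, v, w} p μ α s * coeffMultiplier.{u, v, w} p μ α a =
      coeffMultiplier.{u, v, w} p μ α (α s a) * shiftMultiplier.{u, v, w} p μ α s :=
  Subtype.ext <| ContinuousLinearMap.ext fun x => ext_integratedL fun ρ ξ => by
    simp [ρ.integratedL_mulShift, ρ.π_one, ρ.V_π]

theorem twistAction_mulShift {H : Type*} [Group H] [TopologicalSpace H] (θ : IsoAction H A)
    (hθ : ∀ h g a, θ h (α g a) = α g (θ h a)) (χ : H →* PontryaginDual G)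
    (hχ : Continuous fun q : H × G => χ q.1 q.2) (h : H) (a : A) (s : G)
    (x : LpCrossedProduct.{u, v, w} p μ α) :
    twistAction p μ θ hθ χ hχ h (mulShift p μ α a s x) =
      (χ h s : ℂ) • mulShift p μ α (θ h a) s (twistAction p μ θ hθ χ hχ h x) := by
  have hc := (twistAction.{u, v, w} p μ θ hθ χ hχ h).continuous
  refine (denseRange_ofFn p μ α).induction_on x
    (isClosed_eq (hc.comp (mulShift p μ α a s).continuous)
      (((mulShift p μ α (θ h a) s).continuous.comp hc).const_smul (χ h s : ℂ))) fun f => ?_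
  rw [mulShift_ofFn, twistAction_ofFn, twistAction_ofFn, mulShift_ofFn, ← ofFnₗ_apply,
    ← ofFnₗ_apply, ← map_smul]
  congr 1
  ext t
  have hst : (χ h t : ℂ) = χ h s * χ h (s⁻¹ * t) := by
    rw [← Circle.coe_mul, ← map_mul, mul_inv_cancel_left]
  simp only [twistFn_apply, mulShiftFn_apply, CompactlySupportedContinuousMap.coe_smul,
    Pi.smul_apply, θ.map_mul', hθ, map_smul, hst, mul_smul_comm, mul_smul]

section LocallyCompact

variable [LocallyCompactSpace G]

open scoped Pointwise in
theorem continuous_mulShift_one_ofFn (f : C_c(G, A)) :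
    Continuous fun s => mulShift.{u, v, w} p μ α 1 s (ofFn p μ α f) := by
  refine continuous_iff_continuousAt.2 fun s₀ => tendsto_iff_norm_sub_tendsto_zero.2 ?_
  obtain ⟨N, hN, hs₀⟩ := exists_compact_mem_nhds s₀
  have shift_eq_zero : ∀ s ∈ N, ∀ t ∉ N * tsupport f, mulShiftFn α 1 s f t = 0 :=
    fun s hs t ht => by
      have hf : f (s⁻¹ * t) = 0 := by
        by_contra hne
        exact ht ⟨s, hs, s⁻¹ * t, subset_tsupport _ hne, mul_inv_cancel_left s t⟩
      rw [mulShiftFn_apply, hf, map_zero, mul_zero]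
  have continuous_shift : Continuous fun q : G × G => mulShiftFn α 1 q.1 f q.2 :=
    continuous_const.mul (α.joint.comp (continuous_fst.prodMk (f.continuous.comp (by fun_prop))))
  have continuousOn_integral :
      ContinuousOn (fun s => ∫ t, ‖mulShiftFn α 1 s f t - mulShiftFn α 1 s₀ f t‖ ∂μ) N :=
    continuousOn_integral_of_compact_support (hN.mul f.hasCompactSupport.isCompact)
      (continuous_shift.sub
        (continuous_shift.comp (continuous_const.prodMk continuous_snd))).norm.continuousOn
      fun s t hs ht => by
        rw [shift_eq_zero s hs t ht, shift_eq_zero s₀ (mem_of_mem_nhds hs₀) t ht, sub_zero,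
          norm_zero]
  have integral_tendsto := (continuousOn_integral.continuousAt hs₀).tendsto
  simp only [sub_self, norm_zero, integral_zero] at integral_tendsto
  refine squeeze_zero (fun _ => norm_nonneg _) (fun s => ?_) integral_tendsto
  simp only [mulShift_ofFn]
  rw [← ofFnₗ_apply, ← ofFnₗ_apply, ← map_sub]
  exact norm_ofFn_le_integral _

theorem continuous_mulShift_one (x : LpCrossedProduct.{u, v, w} p μ α) :
    Continuous fun s => mulShift p μ α 1 s x := by
  refine continuous_apply_of_dense_span norm_mulShift_one_le (S := Set.range (ofFn p μ α))
    ((denseRange_ofFn p μ α).mono Submodule.subset_span) ?_ x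
  rintro _ ⟨f, rfl⟩
  exact continuous_mulShift_one_ofFn f

theorem continuous_mulShift (f : C_c(G, A)) (x : LpCrossedProduct.{u, v, w} p μ α) :
    Continuous fun s => mulShift p μ α (f s) s x := by
  let coeffL : A →L[ℂ] (LpCrossedProduct.{u, v, w} p μ α →L[ℂ] LpCrossedProduct p μ α) :=
    ((leftMultiplier ℂ (LpCrossedProduct.{u, v, w} p μ α)).val.comp
      (coeffMultiplier p μ α)).toLinearMap.mkContinuous 1 fun a => by
        rw [one_mul]
        exact norm_mulShift_le a 1
  have h : Continuous fun s => coeffL (f s) (mulShift p μ α 1 s x) :=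
    (coeffL.continuous.comp f.continuous).clm_apply (continuous_mulShift_one x)
  exact h.congr fun s => mulShift_one_mulShift_one (f s) s x

theorem integrable_mulShift (f : C_c(G, A)) (x : LpCrossedProduct.{u, v, w} p μ α) :
    Integrable (fun s => mulShift p μ α (f s) s x) μ :=
  (continuous_mulShift f x).integrable_of_hasCompactSupport <|
    HasCompactSupport.intro f.hasCompactSupport.isCompact fun s hs =>
      ext_integratedL fun ρ ξ => by
        rw [ρ.integratedL_mulShift, image_eq_zero_of_notMem_tsupport hs]
        simp only [map_zero, zero_apply]

theorem ofFn_mul (f : C_c(G, A)) (x : LpCrossedProduct.{u, v, w} p μ α) :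
    ofFn p μ α f * x = ∫ s, mulShift p μ α (f s) s x ∂μ :=
  ext_integratedL fun ρ ξ => by
    rw [ρ.integratedL_mul, ρ.integratedL_ofFn]
    refine Eq.trans ?_ (((ContinuousLinearMap.apply ℂ ρ.E ξ).comp
      (ρ.integratedL μ)).integral_comp_comm (integrable_mulShift f x))
    refine integral_congr_ae (Filter.Eventually.of_forall fun s => ?_)
    exact (ρ.integratedL_mulShift _ _ _ _).symm

end LocallyCompact

end LpCrossedProduct

end MulShift

/-! ### Bump functions and approximate units -/

section Bump

variable {G : Type u} [TopologicalSpace G] [MeasurableSpace G] {μ : Measure G}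
  {U W : Set G} {e : C_c(G, ℝ)}

variable (μ U e) in
/-- `e` is a probability density with respect to `μ` that vanishes off `U`. -/
structure IsBump : Prop where
  nonneg : ∀ s, 0 ≤ e s
  integral_eq_one : ∫ s, e s ∂μ = 1
  eq_zero : ∀ s ∉ U, e s = 0

theorem IsBump.mono (he : IsBump μ U e) (hUW : U ⊆ W) : IsBump μ W e :=
  ⟨he.nonneg, he.integral_eq_one, fun s hs => he.eq_zero s fun h => hs (hUW h)⟩

section Integral

variable [OpensMeasurableSpace G] [IsFiniteMeasureOnCompacts μ] {E : Type*} [NormedAddCommGroup E]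
  [NormedSpace ℝ E]

theorem integrable_smul_of_hasCompactSupport (e : C_c(G, ℝ)) {F : G → E} (hF : Continuous F) :
    Integrable (fun s => e s • F s) μ :=
  (e.continuous.smul hF).integrable_of_hasCompactSupport e.hasCompactSupport.smul_right

theorem IsBump.norm_integral_smul_le (he : IsBump μ U e) {F : G → E} {C : ℝ}
    (hF : ∀ s ∈ U, ‖F s‖ ≤ C) : ‖∫ s, e s • F s ∂μ‖ ≤ C := by
  have integrable_mul : Integrable (fun s => e s * C) μ :=
    (e.continuous.integrable_of_hasCompactSupport e.hasCompactSupport).mul_const C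
  have norm_le (s : G) : ‖e s • F s‖ ≤ e s * C := by
    rw [norm_smul, Real.norm_of_nonneg (he.nonneg s)]
    by_cases hs : s ∈ U
    · exact mul_le_mul_of_nonneg_left (hF s hs) (he.nonneg s)
    · simp only [he.eq_zero s hs, zero_mul, le_rfl]
  refine (norm_integral_le_of_norm_le integrable_mul (.of_forall norm_le)).trans_eq ?_
  rw [integral_mul_const, he.integral_eq_one, one_mul]

end Integral

variable [Group G]

variable (μ) in
/-- The filter of densities with respect to `μ` that concentrate at the identity. -/
def bumpFilter : Filter C_c(G, ℝ) := (𝓝 1).lift' fun U => {e | IsBump μ U e}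

theorem eventually_isBump (hU : U ∈ 𝓝 (1 : G)) : ∀ᶠ e in bumpFilter μ, IsBump μ U e :=
  Filter.mem_lift' hU

theorem exists_isBump [IsTopologicalGroup G] [LocallyCompactSpace G] [BorelSpace G]
    [μ.IsHaarMeasure] (hU : U ∈ 𝓝 (1 : G)) : ∃ e : C_c(G, ℝ), IsBump μ U e := by
  obtain ⟨f, hf1, hf, hfU, hf01⟩ := exists_continuousMap_one_of_isCompact_subset_isOpen
    (isCompact_singleton (x := (1 : G))) isOpen_interior
    (Set.singleton_subset_iff.2 (mem_interior_iff_mem_nhds.2 hU))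
  have integral_pos : 0 < ∫ s, f s ∂μ :=
    f.continuous.integral_pos_of_hasCompactSupport_nonneg_nonzero hf (fun s => (hf01 s).1)
      (x := 1) (by simp [hf1 rfl])
  refine ⟨(∫ s, f s ∂μ)⁻¹ • ⟨f, hf⟩, fun s => ?_, ?_, fun s hs => ?_⟩
  · exact mul_nonneg (inv_nonneg.2 integral_pos.le) (hf01 s).1
  · exact (integral_const_mul _ _).trans (inv_mul_cancel₀ integral_pos.ne')
  · exact mul_eq_zero_of_right _
      (image_eq_zero_of_notMem_tsupport fun h => hs (interior_subset (hfU h)))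

instance [IsTopologicalGroup G] [LocallyCompactSpace G] [BorelSpace G] [μ.IsHaarMeasure] :
    (bumpFilter μ).NeBot :=
  (Filter.lift'_neBot_iff fun _ _ h _ he => he.mono h).2 fun _ hU => exists_isBump hU

theorem tendsto_integral_smul_bumpFilter [OpensMeasurableSpace G] [IsFiniteMeasureOnCompacts μ]
    {E : Type*} [NormedAddCommGroup E] [NormedSpace ℝ E] [CompleteSpace E] {F : G → E}
    (hF : Continuous F) :
    Filter.Tendsto (fun e : C_c(G, ℝ) => ∫ s, e s • F s ∂μ) (bumpFilter μ) (𝓝 (F 1)) := by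
  refine Metric.nhds_basis_closedBall.tendsto_right_iff.2 fun ε hε => ?_
  have close_near_one : {s | dist (F s) (F 1) ≤ ε} ∈ 𝓝 (1 : G) :=
    (hF.tendsto 1).eventually (Metric.closedBall_mem_nhds _ hε)
  filter_upwards [eventually_isBump close_near_one] with e he
  have sub_eq : ∫ s, e s • F s ∂μ - F 1 = ∫ s, e s • (F s - F 1) ∂μ := by
    simp only [smul_sub]
    rw [integral_sub (integrable_smul_of_hasCompactSupport e hF)
      (integrable_smul_of_hasCompactSupport e continuous_const), integral_smul_const,
      he.integral_eq_one, one_smul]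
  rw [mem_closedBall_iff_norm, sub_eq]
  exact he.norm_integral_smul_le fun s hs => by rwa [← dist_eq_norm]

end Bump

section ApproximateUnit

open LpCrossedProduct

variable {p : ℝ≥0∞} [Fact (1 ≤ p)] {G : Type u} [Group G] [TopologicalSpace G]
  {A : Type v} [NormedRing A] [NormedAlgebra ℂ A]

variable (A) in
/-- The `A`-valued function `s ↦ e(s) 1`. -/
def bumpFn (e : C_c(G, ℝ)) : C_c(G, A) where
  toFun s := e s • (1 : A)
  continuous_toFun := e.continuous.smul continuous_const
  hasCompactSupport' := e.hasCompactSupport.smul_right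

variable [MeasurableSpace G] [BorelSpace G] {μ : Measure G} [μ.IsHaarMeasure] {α : IsoAction G A}

theorem CovRep.integrated_bumpFn (ρ : CovRep.{u, v, w} p α) (e : C_c(G, ℝ)) (ξ : ρ.E) :
    ρ.integrated μ (bumpFn A e) ξ = ∫ s, e s • ρ.V s ξ ∂μ := by
  rw [ρ.integrated_apply]
  refine integral_congr_ae (.of_forall fun s => ?_)
  change ρ.π (e s • 1) (ρ.V s ξ) = _
  rw [← Complex.coe_smul, map_smul, ρ.π_one, smul_apply, one_apply_eq_self]
  exact Complex.coe_smul _ _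

theorem CovRep.tendsto_integrated_bumpFn (ρ : CovRep.{u, v, w} p α) (ξ : ρ.E) :
    Filter.Tendsto (fun e => ρ.integrated μ (bumpFn A e) ξ) (bumpFilter μ) (𝓝 ξ) := by
  simpa only [ρ.integrated_bumpFn, map_one, LinearIsometryEquiv.coe_one, id_eq] using
    tendsto_integral_smul_bumpFilter (μ := μ) (ρ.continuous_V ξ)

variable [IsTopologicalGroup G] [CompleteSpace A]

theorem LpCrossedProduct.norm_ofFn_bumpFn_le {U : Set G} {e : C_c(G, ℝ)} (he : IsBump μ U e) :
    ‖ofFn.{u, v, w} p μ α (bumpFn A e)‖ ≤ 1 :=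
  norm_ofFn_le zero_le_one fun ρ => ContinuousLinearMap.opNorm_le_bound _ zero_le_one fun ξ => by
    rw [ρ.integrated_bumpFn, one_mul]
    exact he.norm_integral_smul_le fun s _ => (LinearIsometryEquiv.norm_map _ _).le

variable [LocallyCompactSpace G]

theorem CovRep.isNondegenerateRep_integratedHom (ρ : CovRep.{u, v, w} p α) :
    IsNondegenerateRep (ρ.integratedHom μ) where
  norm_le := ρ.norm_integratedL_le
  topologicalClosure_span := eq_top_iff.2 fun ξ _ =>
    mem_closure_of_tendsto (ρ.tendsto_integrated_bumpFn (μ := μ) ξ) <| .of_forall fun e =>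
      Submodule.subset_span ⟨ofFn p μ α (bumpFn A e), ξ, by
        rw [ρ.integratedHom_apply, ρ.integratedL_ofFn]⟩

namespace LpCrossedProduct

theorem ofFn_bumpFn_mul (e : C_c(G, ℝ)) (x : LpCrossedProduct.{u, v, w} p μ α) :
    ofFn p μ α (bumpFn A e) * x = ∫ s, e s • mulShift p μ α 1 s x ∂μ := by
  rw [ofFn_mul]
  refine integral_congr_ae (.of_forall fun s => ext_integratedL fun ρ ξ => ?_)
  change ρ.integratedL μ (mulShift p μ α (e s • 1) s x) ξ = _
  simp only [← Complex.coe_smul, map_smul, ρ.integratedL_mulShift, smul_apply]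

variable (p μ α) in
theorem hasContractiveLeftApproxUnit :
    HasContractiveLeftApproxUnit (LpCrossedProduct.{u, v, w} p μ α) := by
  refine ⟨(bumpFilter μ).map fun e => ofFn p μ α (bumpFn A e), inferInstance, ?_, fun x => ?_⟩
  · exact Filter.eventually_map.2 <|
      (eventually_isBump Filter.univ_mem).mono fun e he => norm_ofFn_bumpFn_le he
  · have h := tendsto_integral_smul_bumpFilter (μ := μ) (continuous_mulShift_one x)
    have mulShift_one_one : mulShift p μ α 1 1 x = x := by
      rw [← coe_shiftMultiplier, map_one]
      rfl
    rw [mulShift_one_one] at h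
    simpa only [Filter.tendsto_map'_iff, Function.comp_def, ofFn_bumpFn_mul] using h

end LpCrossedProduct

end ApproximateUnit

/-! ### Disintegration -/

section Disintegration

open LpCrossedProduct

variable {p : ℝ≥0∞} [Fact (1 ≤ p)] {G : Type u} [Group G] [TopologicalSpace G]
  [IsTopologicalGroup G] [LocallyCompactSpace G] [MeasurableSpace G] [BorelSpace G]
  {A : Type v} [NormedRing A] [NormedAlgebra ℂ A] [CompleteSpace A]
  {μ : Measure G} [μ.IsHaarMeasure] {α : IsoAction G A} {E : Type*} [NormedAddCommGroup E]
  [NormedSpace ℂ E] [CompleteSpace E]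
  {σ : LpCrossedProduct.{u, v, w} p μ α →ₙₐ[ℂ] (E →L[ℂ] E)}

namespace IsNondegenerateRep

/-- The representation of `A` that underlies a representation of the crossed product. -/
def coeffRep (hσ : IsNondegenerateRep σ) : A →ₐ[ℂ] (E →L[ℂ] E) :=
  (hσ.multiplierRep (hasContractiveLeftApproxUnit p μ α)).comp (coeffMultiplier p μ α)

/-- The isometric representation of `G` that underlies a representation of the crossed product. -/
def shiftRep (hσ : IsNondegenerateRep σ) : G →* (E ≃ₗᵢ[ℂ] E) :=
  isometryHom (((hσ.multiplierRep (hasContractiveLeftApproxUnit p μ α)) :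
    leftMultiplier ℂ (LpCrossedProduct.{u, v, w} p μ α) →* (E →L[ℂ] E)).comp
      (shiftMultiplier p μ α)) fun s =>
    (hσ.norm_multiplierRep_le (hasContractiveLeftApproxUnit p μ α) _).trans (norm_mulShift_one_le s)

variable (hσ : IsNondegenerateRep σ)

theorem coeffRep_apply (a : A) (x : LpCrossedProduct.{u, v, w} p μ α) (ξ : E) :
    hσ.coeffRep a (σ x ξ) = σ (mulShift p μ α a 1 x) ξ :=
  hσ.multiplierRep_apply (hasContractiveLeftApproxUnit p μ α) _ x ξ

theorem shiftRep_apply (s : G) (x : LpCrossedProduct.{u, v, w} p μ α) (ξ : E) :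
    hσ.shiftRep s (σ x ξ) = σ (mulShift p μ α 1 s x) ξ :=
  hσ.multiplierRep_apply (hasContractiveLeftApproxUnit p μ α) _ x ξ

theorem norm_coeffRep_le (a : A) : ‖hσ.coeffRep a‖ ≤ ‖a‖ :=
  (hσ.norm_multiplierRep_le (hasContractiveLeftApproxUnit p μ α) _).trans (norm_mulShift_le a 1)

theorem continuous_shiftRep (ξ : E) : Continuous fun s => hσ.shiftRep s ξ := by
  refine continuous_apply_of_dense_span (𝕜 := ℂ)
    (V := fun s => (hσ.shiftRep s).toContinuousLinearEquiv.toContinuousLinearMap) (C := 1)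
    (fun s => (hσ.shiftRep s).toLinearIsometry.norm_toContinuousLinearMap_le) hσ.dense_span ?_ ξ
  rintro _ ⟨x, ξ, rfl⟩
  exact ((hσ.continuous_apply ξ).comp (continuous_mulShift_one x)).congr fun s =>
    (hσ.shiftRep_apply s x ξ).symm

theorem shiftRep_coeffRep (s : G) (a : A) (ξ : E) :
    hσ.shiftRep s (hσ.coeffRep a ξ) = hσ.coeffRep (α s a) (hσ.shiftRep s ξ) := by
  have h := congrArg (hσ.multiplierRep (hasContractiveLeftApproxUnit p μ α))
    (shiftMultiplier_mul_coeffMultiplier a s)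
  rw [map_mul, map_mul] at h
  exact DFunLike.congr_fun h ξ

end IsNondegenerateRep

variable {X : Type w} [MeasurableSpace X] (ν : Measure X) [SigmaFinite ν]
  {σ : LpCrossedProduct.{u, v, w} p μ α →ₙₐ[ℂ] (Lp ℂ p ν →L[ℂ] Lp ℂ p ν)}
  (hσ : IsNondegenerateRep σ)

namespace LpCrossedProduct

/-- The covariant representation with a given nondegenerate integrated form. -/
def disintegrate : CovRep.{u, v, w} p α where
  X := X
  ν := ν
  π := hσ.coeffRep
  contractive := hσ.norm_coeffRep_le
  nondegenerate := eq_top_iff.2 fun ξ _ => subset_closure <| Submodule.subset_span ⟨1, ξ,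
    (DFunLike.congr_fun (map_one hσ.coeffRep) ξ).symm⟩
  V := hσ.shiftRep
  continuous_V := hσ.continuous_shiftRep
  covariant t a ξ := by
    refine (hσ.shiftRep_coeffRep t a _).trans (congrArg (hσ.coeffRep (α t a)) ?_)
    rw [map_inv]
    exact (hσ.shiftRep t).apply_symm_apply ξ

theorem integrated_disintegrate (f : C_c(G, A)) :
    (disintegrate ν hσ).integrated μ f = σ (ofFn p μ α f) :=
  hσ.ext fun x ξ => by
    let σL : LpCrossedProduct.{u, v, w} p μ α →L[ℂ] (Lp ℂ p ν →L[ℂ] Lp ℂ p ν) :=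
      ⟨(σ : LpCrossedProduct.{u, v, w} p μ α →ₗ[ℂ] (Lp ℂ p ν →L[ℂ] Lp ℂ p ν)), hσ.continuous⟩
    have integrand_eq (s : G) :
        hσ.coeffRep (f s) (hσ.shiftRep s (σ x ξ)) = σ (mulShift p μ α (f s) s x) ξ := by
      rw [hσ.shiftRep_apply, hσ.coeffRep_apply, mulShift_one_mulShift_one]
    have integral_eq : ∫ s, σ (mulShift p μ α (f s) s x) ξ ∂μ = σ (ofFn p μ α f) (σ x ξ) := by
      rw [← mul_apply_eq_comp, ← map_mul, ofFn_mul]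
      exact ((ContinuousLinearMap.apply ℂ (Lp ℂ p ν) ξ).comp σL).integral_comp_comm
        (integrable_mulShift f x)
    exact (integral_congr_ae (.of_forall integrand_eq)).trans integral_eq

end LpCrossedProduct

end Disintegration

/-! ### Iterated crossed products -/

section Iterated

open LpCrossedProduct

variable {p : ℝ≥0∞} [Fact (1 ≤ p)] {G K : Type u} [Group G] [TopologicalSpace G]
  [Group K] [TopologicalSpace K]
  {A : Type v} [NormedRing A] [NormedAlgebra ℂ A]
  {α : IsoAction G A} {θ : IsoAction K A} {χ : K →* PontryaginDual G} {χ' : G →* PontryaginDual K}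

/-- The map `F ↦ ((s, k) ↦ χ'_s(k) F(k, s))`, which extends the label change to an arbitrary pairing
of two groups. -/
def labelSwap (χ' : G →* PontryaginDual K) (hχ' : Continuous fun q : G × K => χ' q.1 q.2)
    (F : C_c(K × G, A)) : C_c(G × K, A) where
  toFun q := (χ' q.1 q.2 : ℂ) • F (q.2, q.1)
  continuous_toFun := (continuous_circle_coe.comp hχ').smul (F.continuous.comp continuous_swap)
  hasCompactSupport' :=
    HasCompactSupport.smul_left (f := fun q : G × K => (χ' q.1 q.2 : ℂ))
      (F.hasCompactSupport.comp_homeomorph (Homeomorph.prodComm G K))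

theorem labelSwap_apply (hχ' : Continuous fun q : G × K => χ' q.1 q.2) (F : C_c(K × G, A)) (s : G)
    (k : K) : labelSwap χ' hχ' F (s, k) = (χ' s k : ℂ) • F (k, s) := rfl

theorem labelSwap_labelSwap (hχ : Continuous fun q : K × G => χ q.1 q.2)
    (hχ' : Continuous fun q : G × K => χ' q.1 q.2) (hχχ' : ∀ k s, χ' s k = (χ k s)⁻¹)
    (F : C_c(K × G, A)) : labelSwap χ hχ (labelSwap χ' hχ' F) = F :=
  CompactlySupportedContinuousMap.ext fun ⟨k, s⟩ => by
    rw [labelSwap_apply, labelSwap_apply, ← mul_smul, hχχ', ← Circle.coe_mul, mul_inv_cancel,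
      Circle.coe_one, one_smul]

variable (p α θ χ) in
/-- A representation of `A` with covariant isometric representations `V` (in `base`) and `U` of two
groups acting on `A`, subject to the commutation relation `U_k V_s = χ_k(s) V_s U_k`. These are the
disintegrated forms of the covariant representations of an iterated crossed product. -/
structure BiCovRep where
  base : CovRep.{u, v, w} p α
  U : K →* (base.E ≃ₗᵢ[ℂ] base.E)
  continuous_U : ∀ ξ, Continuous fun k => U k ξ
  U_π : ∀ k a ξ, U k (base.π a ξ) = base.π (θ k a) (U k ξ)
  U_V : ∀ k s ξ, U k (base.V s ξ) = (χ k s : ℂ) • base.V s (U k ξ)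

namespace BiCovRep

variable (D : BiCovRep.{u, v, w} p α θ χ)

theorem U_U_inv (k : K) (ξ : D.base.E) : D.U k (D.U k⁻¹ ξ) = ξ := by
  rw [map_inv]
  exact (D.U k).apply_symm_apply ξ

theorem V_U (hχχ' : ∀ k s, χ' s k = (χ k s)⁻¹) (s : G) (k : K) (ξ : D.base.E) :
    D.base.V s (D.U k ξ) = (χ' s k : ℂ) • D.U k (D.base.V s ξ) := by
  rw [D.U_V, hχχ', ← mul_smul, ← Circle.coe_mul, inv_mul_cancel, Circle.coe_one, one_smul]

/-- The covariant representation of the second group. -/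
def swapBase : CovRep.{u, v, w} p θ where
  X := D.base.X
  ν := D.base.ν
  π := D.base.π
  contractive := D.base.contractive
  nondegenerate := D.base.nondegenerate
  V := D.U
  continuous_V := D.continuous_U
  covariant k a ξ := (D.U_π k a _).trans (congrArg (D.base.π (θ k a)) (D.U_U_inv k ξ))

/-- Exchange the two groups. -/
def swap (hχχ' : ∀ k s, χ' s k = (χ k s)⁻¹) : BiCovRep.{u, v, w} p θ α χ' where
  base := D.swapBase
  U := D.base.V
  continuous_U := D.base.continuous_V
  U_π := D.base.V_π
  U_V := D.V_U hχχ'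

section Integral

variable [IsTopologicalGroup G] [MeasurableSpace G] [BorelSpace G] {μ : Measure G}
  [μ.IsHaarMeasure] [MeasurableSpace K]
  {κ : Measure K}

variable (μ κ) in
/-- The integrated form `ξ ↦ ∫∫ π(F(k, s)) V_s U_k ξ`. -/
def iteratedIntegral (F : C_c(K × G, A)) (ξ : D.base.E) : D.base.E :=
  ∫ k, D.base.integrated μ (sectionFn F k) (D.U k ξ) ∂κ

theorem iteratedIntegral_swap [IsTopologicalGroup K] [BorelSpace K] [κ.IsHaarMeasure]
    (hχχ' : ∀ k s, χ' s k = (χ k s)⁻¹) (hχ' : Continuous fun q : G × K => χ' q.1 q.2)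
    (F : C_c(K × G, A)) (ξ : D.base.E) :
    (D.swap hχχ').iteratedIntegral κ μ (labelSwap χ' hχ' F) ξ = D.iteratedIntegral μ κ F ξ := by
  let integrand (k : K) (s : G) : D.base.E := D.base.π (F (k, s)) (D.base.V s (D.U k ξ))
  have continuous_integrand : Continuous (Function.uncurry integrand) :=
    D.base.continuous_integrand F.continuous continuous_snd
      ((D.continuous_U ξ).comp continuous_fst)
  have hasCompactSupport_integrand : HasCompactSupport (Function.uncurry integrand) :=
    HasCompactSupport.intro F.hasCompactSupport.isCompact fun q hq => by
      change D.base.π (F q) (D.base.V q.2 (D.U q.1 ξ)) = 0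
      rw [image_eq_zero_of_notMem_tsupport hq, map_zero, zero_apply]
  have swap_integrand (s : G) (k : K) :
      D.base.π (labelSwap χ' hχ' F (s, k)) (D.U k (D.base.V s ξ)) = integrand k s := by
    rw [D.U_V, labelSwap_apply, map_smul, map_smul, smul_apply, ← mul_smul, hχχ',
      ← Circle.coe_mul, mul_inv_cancel, Circle.coe_one, one_smul]
  calc (∫ s, ∫ k, D.base.π (labelSwap χ' hχ' F (s, k)) (D.U k (D.base.V s ξ)) ∂κ ∂μ)
      = ∫ s, ∫ k, integrand k s ∂κ ∂μ := by simp only [swap_integrand]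
    _ = ∫ k, ∫ s, integrand k s ∂μ ∂κ :=
      (integral_integral_swap_of_hasCompactSupport continuous_integrand
        hasCompactSupport_integrand).symm

end Integral

variable [IsTopologicalGroup G] [MeasurableSpace G] [BorelSpace G] [CompleteSpace A]
  {μ : Measure G} [μ.IsHaarMeasure] (hθ : ∀ k s a, θ k (α s a) = α s (θ k a))
  (hχ : Continuous fun q : K × G => χ q.1 q.2)

theorem U_integratedL (k : K) (x : LpCrossedProduct.{u, v, w} p μ α) (ξ : D.base.E) :
    D.U k (D.base.integratedL μ x ξ) =
      D.base.integratedL μ (twistAction p μ θ hθ χ hχ k x) (D.U k ξ) := by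
  refine (denseRange_ofFn p μ α).induction_on x
    (isClosed_eq ((D.U k).continuous.comp (D.base.continuous_integratedL_apply ξ))
      ((D.base.continuous_integratedL_apply _).comp (twistAction p μ θ hθ χ hχ k).continuous))
    fun f => ?_
  rw [twistAction_ofFn, D.base.integratedL_ofFn, D.base.integratedL_ofFn]
  refine Eq.trans ((D.U k).toContinuousLinearEquiv.toContinuousLinearMap.integral_comp_comm
    (D.base.integrable_integrand μ f ξ)).symm (integral_congr_ae (.of_forall fun s => ?_))
  change D.U k (D.base.π (f s) (D.base.V s ξ)) =
    D.base.π ((χ k s : ℂ) • θ k (f s)) (D.base.V s (D.U k ξ))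
  rw [D.U_π, D.U_V, map_smul, map_smul, smul_apply]

variable [LocallyCompactSpace G]

variable (μ) in
/-- The covariant representation of the crossed product by the first group. -/
def toCovRep : CovRep.{u, max u v, w} p (twistAction.{u, v, w} p μ θ hθ χ hχ) where
  X := D.base.X
  ν := D.base.ν
  π := D.base.integratedHom μ
  contractive := D.base.norm_integratedL_le
  nondegenerate := D.base.isNondegenerateRep_integratedHom.topologicalClosure_span
  V := D.U
  continuous_V := D.continuous_U
  covariant k x ξ := by
    refine (D.U_integratedL hθ hχ k x (D.U k⁻¹ ξ)).trans ?_
    rw [D.U_U_inv]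
    rfl

theorem integrated_toCovRep [IsTopologicalGroup K] [MeasurableSpace K] [BorelSpace K]
    {κ : Measure K} [κ.IsHaarMeasure] (F : C_c(K × G, A)) (ξ : D.base.E) :
    (D.toCovRep μ hθ hχ).integrated κ (sectionMap p μ α F) ξ = D.iteratedIntegral μ κ F ξ :=
  integral_congr_ae <| .of_forall fun k =>
    DFunLike.congr_fun (D.base.integratedL_ofFn (sectionFn F k)) (D.U k ξ)

end BiCovRep

namespace CovRep

variable [IsTopologicalGroup G] [MeasurableSpace G] [BorelSpace G] [LocallyCompactSpace G]
  [CompleteSpace A] {μ : Measure G} [μ.IsHaarMeasure]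
  {hθ : ∀ k s a, θ k (α s a) = α s (θ k a)} {hχ : Continuous fun q : K × G => χ q.1 q.2}
  (ρ : CovRep.{u, max u v, w} p (twistAction.{u, v, w} p μ θ hθ χ hχ))

theorem V_coeffRep (k : K) (a : A) (ξ : ρ.E) :
    ρ.V k (ρ.isNondegenerateRep.coeffRep a ξ) =
      ρ.isNondegenerateRep.coeffRep (θ k a) (ρ.V k ξ) := by
  let U : ρ.E →L[ℂ] ρ.E := (ρ.V k).toContinuousLinearEquiv.toContinuousLinearMap
  suffices U * ρ.isNondegenerateRep.coeffRep a = ρ.isNondegenerateRep.coeffRep (θ k a) * U from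
    DFunLike.congr_fun this ξ
  refine ρ.isNondegenerateRep.ext fun x ξ => ?_
  change ρ.V k (ρ.isNondegenerateRep.coeffRep a (ρ.π x ξ)) =
    ρ.isNondegenerateRep.coeffRep (θ k a) (ρ.V k (ρ.π x ξ))
  simp only [IsNondegenerateRep.coeffRep_apply, ρ.V_π, twistAction_mulShift, map_one,
    Circle.coe_one, one_smul]

theorem V_shiftRep (k : K) (s : G) (ξ : ρ.E) :
    ρ.V k (ρ.isNondegenerateRep.shiftRep s ξ) =
      (χ k s : ℂ) • ρ.isNondegenerateRep.shiftRep s (ρ.V k ξ) := by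
  let U : ρ.E →L[ℂ] ρ.E := (ρ.V k).toContinuousLinearEquiv.toContinuousLinearMap
  let V : ρ.E →L[ℂ] ρ.E :=
    (ρ.isNondegenerateRep.shiftRep s).toContinuousLinearEquiv.toContinuousLinearMap
  suffices U * V = (χ k s : ℂ) • (V * U) from DFunLike.congr_fun this ξ
  refine ρ.isNondegenerateRep.ext fun x ξ => ?_
  change ρ.V k (ρ.isNondegenerateRep.shiftRep s (ρ.π x ξ)) =
    (χ k s : ℂ) • ρ.isNondegenerateRep.shiftRep s (ρ.V k (ρ.π x ξ))
  simp only [IsNondegenerateRep.shiftRep_apply, ρ.V_π, twistAction_mulShift, θ.apply_one,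
    map_smul, smul_apply]

/-- The disintegration of a covariant representation of a crossed product. -/
def toBiCovRep : BiCovRep.{u, v, w} p α θ χ where
  base := disintegrate ρ.ν ρ.isNondegenerateRep
  U := ρ.V
  continuous_U := ρ.continuous_V
  U_π := ρ.V_coeffRep
  U_V := ρ.V_shiftRep

variable [IsTopologicalGroup K] [MeasurableSpace K] [BorelSpace K] {κ : Measure K}
  [κ.IsHaarMeasure]

theorem iteratedIntegral_toBiCovRep (F : C_c(K × G, A)) (ξ : ρ.E) :
    ρ.toBiCovRep.iteratedIntegral μ κ F ξ = ρ.integrated κ (sectionMap p μ α F) ξ :=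
  integral_congr_ae <| .of_forall fun k => DFunLike.congr_fun
    (integrated_disintegrate ρ.ν ρ.isNondegenerateRep (sectionFn F k)) (ρ.V k ξ)

variable [LocallyCompactSpace K] (hχχ' : ∀ k s, χ' s k = (χ k s)⁻¹)
  (hχ' : Continuous fun q : G × K => χ' q.1 q.2)

variable (κ) in
/-- The covariant representation, on the same space, of the crossed product iterated in the other
order. -/
def swap : CovRep.{u, max u v, w} p
    (twistAction.{u, v, w} p κ α (fun s k a => (hθ k s a).symm) χ' hχ') :=
  (ρ.toBiCovRep.swap hχχ').toCovRep κ _ hχ'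

theorem integrated_swap (F : C_c(K × G, A)) (ξ : ρ.E) :
    (ρ.swap κ hχχ' hχ').integrated μ (sectionMap p κ θ (labelSwap χ' hχ' F)) ξ =
      ρ.integrated κ (sectionMap p μ α F) ξ :=
  ((ρ.toBiCovRep.swap hχχ').integrated_toCovRep _ hχ' _ ξ).trans <|
    (ρ.toBiCovRep.iteratedIntegral_swap hχχ' hχ' F ξ).trans (ρ.iteratedIntegral_toBiCovRep F ξ)

end CovRep

end Iterated

/-! ### Density of the functions of two variables -/

section Density

theorem exists_sum_smul_near {K ι E : Type*} [TopologicalSpace K] [T2Space K]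
    [LocallyCompactSpace K] [NormedAddCommGroup E] [NormedSpace ℝ E] {e : ι → E}
    (he : DenseRange e) (h : C_c(K, E)) {N : Set K} (hN : tsupport h ⊆ interior N) {δ : ℝ}
    (hδ : 0 < δ) :
    ∃ (t : Finset ι) (φ : t → C_c(K, ℝ)),
      (∀ k, ‖h k - ∑ i, φ i k • e i‖ ≤ δ) ∧ ∀ k ∉ N, h k = ∑ i, φ i k • e i := by
  let U (i : ι) : Set K := {k | dist (h k) (e i) < δ} ∩ interior N
  have isOpen_U (i : ι) : IsOpen (U i) :=
    (isOpen_lt (h.continuous.dist continuous_const) continuous_const).inter isOpen_interior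
  obtain ⟨t, ht⟩ := h.hasCompactSupport.isCompact.elim_finite_subcover U isOpen_U fun k hk =>
    let ⟨i, hi⟩ := he.exists_dist_lt (h k) hδ
    Set.mem_iUnion.2 ⟨i, hi, hN hk⟩
  obtain ⟨φ, φ_subordinate, hasCompactSupport_φ⟩ :=
    PartitionOfUnity.exists_isSubordinate_of_locallyFinite_t2space h.hasCompactSupport.isCompact
      (fun i : t => U i) (fun i => isOpen_U i) (locallyFinite_of_finite _)
      (by simpa only [Set.iUnion_subtype] using ht)
  have mem_U {i : t} {k : K} (hik : φ i k ≠ 0) : k ∈ U i :=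
    φ_subordinate i (subset_tsupport _ hik)
  have sum_smul_h (k : K) : h k = ∑ i, φ i k • h k := by
    by_cases hk : k ∈ tsupport h
    · rw [← Finset.sum_smul, ← finsum_eq_sum_of_fintype, φ.sum_eq_one hk, one_smul]
    · simp only [image_eq_zero_of_notMem_tsupport hk, smul_zero, Finset.sum_const_zero]
  have sub_eq (k : K) : h k - ∑ i, φ i k • e i = ∑ i, φ i k • (h k - e i) := by
    simp only [smul_sub, Finset.sum_sub_distrib, ← sum_smul_h]
  refine ⟨t, fun i => ⟨φ i, hasCompactSupport_φ i⟩, fun k => ?_, fun k hk => ?_⟩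
  · have norm_term_le (i : t) : ‖φ i k • (h k - e i)‖ ≤ φ i k * δ := by
      rw [norm_smul, Real.norm_of_nonneg (φ.nonneg i k), ← dist_eq_norm]
      rcases eq_or_ne (φ i k) 0 with hik | hik
      · simp only [hik, zero_mul, le_refl]
      · exact mul_le_mul_of_nonneg_left (mem_U hik).1.le (φ.nonneg i k)
    calc ‖h k - ∑ i, φ i k • e i‖ = ‖∑ i, φ i k • (h k - e i)‖ := by rw [sub_eq]
      _ ≤ ∑ i, φ i k * δ := norm_sum_le_of_le _ fun i _ => norm_term_le i
      _ = (∑ᶠ i, φ i k) * δ := by rw [← Finset.sum_mul, finsum_eq_sum_of_fintype]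
      _ ≤ δ := mul_le_of_le_one_left hδ.le (φ.sum_le_one k)
  · have φ_eq_zero (i : t) : φ i k = 0 := by_contra fun hik => hk (interior_subset (mem_U hik).2)
    refine sub_eq_zero.1 ((sub_eq k).trans (Finset.sum_eq_zero fun i _ => ?_))
    rw [φ_eq_zero, zero_smul]

open LpCrossedProduct

variable {p : ℝ≥0∞} [Fact (1 ≤ p)] {G K : Type u} [Group G] [TopologicalSpace G]
  [IsTopologicalGroup G] [MeasurableSpace G] [BorelSpace G]
  [Group K] [TopologicalSpace K] [IsTopologicalGroup K]

theorem LpCrossedProduct.dist_ofFn_le {B : Type v} [NonUnitalNormedRing B] [NormedSpace ℂ B]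
    [IsScalarTower ℂ B B] [SMulCommClass ℂ B B] [CompleteSpace B] {μ : Measure G}
    [μ.IsHaarMeasure] {α : IsoAction G B} {f g : C_c(G, B)} {N : Set G} (hN : IsCompact N) {δ : ℝ}
    (hfg : ∀ s, ‖f s - g s‖ ≤ δ) (hfg' : ∀ s ∉ N, f s = g s) :
    dist (ofFn.{u, v, w} p μ α f) (ofFn p μ α g) ≤ δ * μ.real N :=
  calc dist (ofFn.{u, v, w} p μ α f) (ofFn p μ α g) = ‖ofFn.{u, v, w} p μ α (f - g)‖ := by
        rw [dist_eq_norm, ← ofFnₗ_apply, ← ofFnₗ_apply, ← map_sub, ofFnₗ_apply]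
    _ ≤ ∫ s, ‖f s - g s‖ ∂μ := norm_ofFn_le_integral _
    _ = ∫ s in N, ‖f s - g s‖ ∂μ :=
      (setIntegral_eq_integral_of_forall_compl_eq_zero fun s hs => by
        rw [hfg' s hs, sub_self, norm_zero]).symm
    _ ≤ ‖∫ s in N, ‖f s - g s‖ ∂μ‖ := Real.le_norm_self _
    _ ≤ δ * μ.real N := norm_setIntegral_le_of_norm_le_const hN.measure_lt_top fun s _ =>
      (norm_norm _).trans_le (hfg s)

variable {A : Type v} [NormedRing A] [NormedAlgebra ℂ A]

/-- The function `(k, s) ↦ φ(k) f(s)`. -/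
def tensorFn (φ : C_c(K, ℝ)) (f : C_c(G, A)) : C_c(K × G, A) where
  toFun q := φ q.1 • f q.2
  continuous_toFun := (φ.continuous.comp continuous_fst).smul (f.continuous.comp continuous_snd)
  hasCompactSupport' := HasCompactSupport.intro
    (φ.hasCompactSupport.isCompact.prod f.hasCompactSupport.isCompact) fun q hq => by
      rcases not_and_or.1 hq with h | h
      · rw [image_eq_zero_of_notMem_tsupport h, zero_smul]
      · rw [image_eq_zero_of_notMem_tsupport h, smul_zero]

variable [CompleteSpace A] {μ : Measure G} [μ.IsHaarMeasure] {α : IsoAction G A}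

variable (p μ α) in
/-- The map `sectionMap` as a linear map. -/
def sectionMapₗ : C_c(K × G, A) →ₗ[ℂ] C_c(K, LpCrossedProduct.{u, v, w} p μ α) where
  toFun := sectionMap p μ α
  map_add' F F' := by
    ext k
    exact map_add (ofFnₗ.{u, v, w} p μ α) (sectionFn F k) (sectionFn F' k)
  map_smul' c F := by
    ext k
    exact map_smul (ofFnₗ.{u, v, w} p μ α) c (sectionFn F k)

theorem sectionMap_tensorFn (φ : C_c(K, ℝ)) (f : C_c(G, A)) (k : K) :
    sectionMap.{u, v, w} p μ α (tensorFn φ f) k = φ k • ofFn p μ α f := by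
  have sectionFn_tensorFn : sectionFn (tensorFn φ f) k = (φ k : ℂ) • f := by
    ext s
    exact (Complex.coe_smul _ _).symm
  change ofFnₗ.{u, v, w} p μ α (sectionFn (tensorFn φ f) k) = _
  rw [sectionFn_tensorFn, map_smul, Complex.coe_smul, ofFnₗ_apply]

theorem sectionMap_sum_tensorFn {ι : Type*} (t : Finset ι) (φ : ι → C_c(K, ℝ)) (f : ι → C_c(G, A))
    (k : K) : sectionMap.{u, v, w} p μ α (∑ i ∈ t, tensorFn (φ i) (f i)) k =
      ∑ i ∈ t, φ i k • ofFn p μ α (f i) := by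
  change sectionMapₗ.{u, v, w} p μ α (∑ i ∈ t, tensorFn (φ i) (f i)) k = _
  rw [map_sum, CompactlySupportedContinuousMap.coe_sum, Finset.sum_apply]
  exact Finset.sum_congr rfl fun i _ => sectionMap_tensorFn (φ i) (f i) k

variable [MeasurableSpace K] [BorelSpace K] (κ : Measure K) [κ.IsHaarMeasure]
  (τ : IsoAction K (LpCrossedProduct.{u, v, w} p μ α))

/-- The linear map from the functions of two variables to an iterated crossed product. -/
def iteratedOfFnₗ : C_c(K × G, A) →ₗ[ℂ] LpCrossedProduct.{u, max u v, w} p κ τ :=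
  ofFnₗ p κ τ ∘ₗ sectionMapₗ p μ α

theorem iteratedOfFnₗ_apply (F : C_c(K × G, A)) :
    iteratedOfFnₗ.{u, v, w} κ τ F = ofFn p κ τ (sectionMap p μ α F) := rfl

theorem denseRange_iteratedOfFnₗ [T2Space K] [LocallyCompactSpace K] :
    DenseRange (iteratedOfFnₗ.{u, v, w} κ τ) := by
  refine fun x => Metric.mem_closure_range_iff.2 fun ε hε => ?_
  obtain ⟨h, hh⟩ := (denseRange_ofFn p κ τ).exists_dist_lt x (half_pos hε)
  obtain ⟨N, hN, hsN⟩ := exists_compact_superset h.hasCompactSupport.isCompact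
  have hκN : 0 < κ.real N + 1 := by positivity
  obtain ⟨t, φ, hφ, hφN⟩ :=
    exists_sum_smul_near (denseRange_ofFn p μ α) h hsN (div_pos (half_pos hε) hκN)
  let F : C_c(K × G, A) := ∑ i, tensorFn (φ i) i
  have sectionMap_F (k : K) : sectionMap.{u, v, w} p μ α F k = ∑ i, φ i k • ofFn p μ α i :=
    sectionMap_sum_tensorFn _ φ _ k
  simp only [← sectionMap_F] at hφ hφN
  refine ⟨F, ?_⟩
  calc dist x (iteratedOfFnₗ κ τ F)
      ≤ dist x (ofFn p κ τ h) + dist (ofFn p κ τ h) (ofFn p κ τ (sectionMap p μ α F)) :=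
        dist_triangle _ _ _
    _ ≤ dist x (ofFn p κ τ h) + ε / 2 / (κ.real N + 1) * κ.real N := by
        gcongr
        exact dist_ofFn_le hN hφ hφN
    _ ≤ dist x (ofFn p κ τ h) + ε / 2 := by
        gcongr
        rw [div_mul_eq_mul_div]
        exact div_le_of_le_mul₀ hκN.le (half_pos hε).le (by gcongr; linarith)
    _ < ε := by linarith

end Density

/-! ### The label change -/

section LabelChange

open LpCrossedProduct

variable {p : ℝ≥0∞} [Fact (1 ≤ p)] {G K : Type u} [Group G] [TopologicalSpace G]
  [Group K] [TopologicalSpace K]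
  {A : Type v} [NormedRing A] [NormedAlgebra ℂ A]
  {χ : K →* PontryaginDual G} {χ' : G →* PontryaginDual K}

/-- The map `labelSwap` as a linear bijection. -/
def labelSwapEquiv (hχχ' : ∀ k s, χ' s k = (χ k s)⁻¹)
    (hχ : Continuous fun q : K × G => χ q.1 q.2)
    (hχ' : Continuous fun q : G × K => χ' q.1 q.2) : C_c(K × G, A) ≃ₗ[ℂ] C_c(G × K, A) where
  toFun := labelSwap χ' hχ'
  map_add' F F' := by
    ext q
    exact smul_add _ _ _
  map_smul' c F := by
    ext q
    exact smul_comm _ _ _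
  invFun := labelSwap χ hχ
  left_inv := labelSwap_labelSwap hχ hχ' hχχ'
  right_inv := labelSwap_labelSwap hχ' hχ fun s k => (inv_eq_iff_eq_inv.2 (hχχ' k s)).symm

theorem labelSwapEquiv_apply (hχχ' : ∀ k s, χ' s k = (χ k s)⁻¹)
    (hχ : Continuous fun q : K × G => χ q.1 q.2) (hχ' : Continuous fun q : G × K => χ' q.1 q.2)
    (F : C_c(K × G, A)) : labelSwapEquiv hχχ' hχ hχ' F = labelSwap χ' hχ' F := rfl

variable [IsTopologicalGroup G] [LocallyCompactSpace G] [MeasurableSpace G] [BorelSpace G]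
  [IsTopologicalGroup K] [LocallyCompactSpace K] [MeasurableSpace K] [BorelSpace K]
  [CompleteSpace A]
  {μ : Measure G} [μ.IsHaarMeasure] {κ : Measure K} [κ.IsHaarMeasure]
  {α : IsoAction G A} {θ : IsoAction K A}
  {hθ : ∀ k s a, θ k (α s a) = α s (θ k a)} {hχ : Continuous fun q : K × G => χ q.1 q.2}
  {hχ' : Continuous fun q : G × K => χ' q.1 q.2}

variable (hθ hχ hχ') in
theorem norm_iteratedOfFnₗ_le (hχχ' : ∀ k s, χ' s k = (χ k s)⁻¹)
    (F : C_c(K × G, A)) :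
    ‖iteratedOfFnₗ.{u, v, w} κ (twistAction p μ θ hθ χ hχ) F‖ ≤
      ‖iteratedOfFnₗ.{u, v, w} μ (twistAction p κ α (fun s k a => (hθ k s a).symm) χ' hχ')
        (labelSwap χ' hχ' F)‖ :=
  norm_ofFn_le (norm_nonneg _) fun ρ => by
    have integrated_eq : ρ.integrated κ (sectionMap p μ α F) =
        (ρ.swap κ hχχ' hχ').integrated μ (sectionMap p κ θ (labelSwap χ' hχ' F)) :=
      ContinuousLinearMap.ext fun ξ => (ρ.integrated_swap hχχ' hχ' F ξ).symm
    refine (congrArg norm integrated_eq).trans_le ?_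
    exact (ρ.swap κ hχχ' hχ').norm_integrated_le_norm_ofFn _

variable (hθ hχ hχ') in
theorem norm_iteratedOfFnₗ_labelSwapEquiv (hχχ' : ∀ k s, χ' s k = (χ k s)⁻¹)
    (F : C_c(K × G, A)) :
    ‖iteratedOfFnₗ.{u, v, w} μ (twistAction p κ α (fun s k a => (hθ k s a).symm) χ' hχ')
        (labelSwapEquiv hχχ' hχ hχ' F)‖ =
      ‖iteratedOfFnₗ.{u, v, w} κ (twistAction p μ θ hθ χ hχ) F‖ := by
  rw [labelSwapEquiv_apply]
  refine le_antisymm ?_ (norm_iteratedOfFnₗ_le hθ hχ hχ' hχχ' F)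
  refine (norm_iteratedOfFnₗ_le (fun s k a => (hθ k s a).symm) hχ' hχ
    (fun s k => (inv_eq_iff_eq_inv.2 (hχχ' k s)).symm) _).trans_eq ?_
  rw [labelSwap_labelSwap hχ hχ' hχχ']

variable [T2Space G] [T2Space K]

variable (p μ κ hθ hχ hχ') in
/-- The isometric isomorphism between the two iterated crossed products, induced by `labelSwap`. -/
def iteratedIso (hχχ' : ∀ k s, χ' s k = (χ k s)⁻¹) :
    LpCrossedProduct.{u, max u v, w} p κ (twistAction.{u, v, w} p μ θ hθ χ hχ) ≃ₗᵢ[ℂ]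
    LpCrossedProduct.{u, max u v, w} p μ
      (twistAction.{u, v, w} p κ α (fun s k a => (hθ k s a).symm) χ' hχ') :=
  (labelSwapEquiv hχχ' hχ hχ').extendOfIsometry (iteratedOfFnₗ κ (twistAction p μ θ hθ χ hχ))
    (iteratedOfFnₗ μ (twistAction p κ α (fun s k a => (hθ k s a).symm) χ' hχ'))
    (denseRange_iteratedOfFnₗ κ _) (denseRange_iteratedOfFnₗ μ _)
    fun F => by rw [norm_iteratedOfFnₗ_labelSwapEquiv]

theorem iteratedIso_iteratedOfFnₗ (hχχ' : ∀ k s, χ' s k = (χ k s)⁻¹) (F : C_c(K × G, A)) :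
    iteratedIso p μ κ hθ hχ hχ' hχχ' (iteratedOfFnₗ.{u, v, w} κ _ F) =
      iteratedOfFnₗ μ _ (labelSwap χ' hχ' F) := by
  rw [iteratedIso, LinearEquiv.extendOfIsometry_eq, labelSwapEquiv_apply]

theorem integratedL_swap_iteratedIso (hχχ' : ∀ k s, χ' s k = (χ k s)⁻¹)
    (ρ : CovRep.{u, max u v, w} p (twistAction.{u, v, w} p μ θ hθ χ hχ))
    (x : LpCrossedProduct.{u, max u v, w} p κ (twistAction.{u, v, w} p μ θ hθ χ hχ)) (ξ : ρ.E) :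
    (ρ.swap κ hχχ' hχ').integratedL μ (iteratedIso.{u, v, w} p μ κ hθ hχ hχ' hχχ' x) ξ =
      ρ.integratedL κ x ξ := by
  refine (denseRange_iteratedOfFnₗ κ _).induction_on x (isClosed_eq
    (((ρ.swap κ hχχ' hχ').continuous_integratedL_apply ξ).comp
      (iteratedIso.{u, v, w} p μ κ hθ hχ hχ' hχχ').continuous)
    (ρ.continuous_integratedL_apply ξ)) fun F => ?_
  rw [iteratedIso_iteratedOfFnₗ, iteratedOfFnₗ_apply, iteratedOfFnₗ_apply,
    CovRep.integratedL_ofFn, CovRep.integratedL_ofFn]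
  exact ρ.integrated_swap hχχ' hχ' F ξ

theorem iteratedIso_mul (hχχ' : ∀ k s, χ' s k = (χ k s)⁻¹)
    (x y : LpCrossedProduct.{u, max u v, w} p κ (twistAction.{u, v, w} p μ θ hθ χ hχ)) :
    iteratedIso.{u, v, w} p μ κ hθ hχ hχ' hχχ' (x * y) =
      iteratedIso p μ κ hθ hχ hχ' hχχ' x * iteratedIso p μ κ hθ hχ hχ' hχχ' y := by
  let Φ := iteratedIso.{u, v, w} p μ κ hθ hχ hχ' hχχ'
  suffices x * y = Φ.symm (Φ x * Φ y) from
    (congrArg Φ this).trans (Φ.apply_symm_apply _)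
  refine ext_integratedL fun ρ ξ => ?_
  have integratedL_Φ (z) (η : ρ.E) :
      (ρ.swap κ hχχ' hχ').integratedL μ (Φ z) η = ρ.integratedL κ z η :=
    integratedL_swap_iteratedIso hχχ' ρ z η
  rw [← integratedL_Φ (Φ.symm _), Φ.apply_symm_apply, ρ.integratedL_mul,
    (ρ.swap κ hχχ' hχ').integratedL_mul]
  exact (integratedL_Φ x _).trans (congrArg (ρ.integratedL κ x) (integratedL_Φ y ξ)) |>.symm

theorem eq_iteratedIso (hχχ' : ∀ k s, χ' s k = (χ k s)⁻¹)
    {Ψ : LpCrossedProduct.{u, max u v, w} p κ (twistAction.{u, v, w} p μ θ hθ χ hχ) ≃ₗᵢ[ℂ]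
      LpCrossedProduct.{u, max u v, w} p μ
        (twistAction.{u, v, w} p κ α (fun s k a => (hθ k s a).symm) χ' hχ')}
    (hΨ : ∀ F : C_c(K × G, A), Ψ (iteratedOfFnₗ κ _ F) =
      iteratedOfFnₗ μ _ (labelSwap χ' hχ' F)) :
    Ψ = iteratedIso p μ κ hθ hχ hχ' hχχ' :=
  LinearIsometryEquiv.ext fun x => (denseRange_iteratedOfFnₗ κ _).induction_on x
    (isClosed_eq Ψ.continuous (iteratedIso p μ κ hθ hχ hχ' hχχ').continuous)
    fun F => (hΨ F).trans (iteratedIso_iteratedOfFnₗ hχχ' F).symm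

end LabelChange

end LpCrossed

end

theorem proposition3p1_general (p : ℝ≥0∞) [Fact (1 ≤ p)]
    {G : Type u} [CommGroup G] [TopologicalSpace G] [IsTopologicalGroup G] [LocallyCompactSpace G]
    [T2Space G] [MeasurableSpace G] [BorelSpace G] (μ : Measure G) [μ.IsHaarMeasure]
    [MeasurableSpace (PontryaginDual G)] [BorelSpace (PontryaginDual G)]
    (m : Measure (PontryaginDual G)) [m.IsHaarMeasure]
    {A : Type v} [NormedRing A] [NormedAlgebra ℂ A] [CompleteSpace A]
    (α : LpCrossed.IsoAction G A) :
    ∃! Φ : LpCrossed.LpCrossedProduct.{u, max u v, w} p m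
          (LpCrossed.dualAction.{u, v, w} p μ α) ≃ₗᵢ[ℂ]
        LpCrossed.LpCrossedProduct.{u, max u v, w} p μ
          (LpCrossed.dualTensorAction.{u, v, w} p m α),
      (∀ x y, Φ (x * y) = Φ x * Φ y) ∧
      ∀ F : C_c(PontryaginDual G × G, A),
        Φ (LpCrossed.LpCrossedProduct.ofFn p m _ (LpCrossed.sectionMap p μ α F)) =
          LpCrossed.LpCrossedProduct.ofFn p μ _
            (LpCrossed.sectionMap p m (LpCrossed.IsoAction.trivial (PontryaginDual G) A)
              (LpCrossed.labelChange F)) := by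
  have hχχ' (γ : PontryaginDual G) (s : G) :
      LpCrossed.evalHom G s γ = (invMonoidHom (α := PontryaginDual G) γ s)⁻¹ :=
    (inv_inv _).symm
  refine ⟨LpCrossed.iteratedIso.{u, v, w} p μ m (LpCrossed.trivial_comm α)
    LpCrossed.continuous_inv_apply LpCrossed.continuous_evalHom_apply hχχ',
    ⟨LpCrossed.iteratedIso_mul hχχ', LpCrossed.iteratedIso_iteratedOfFnₗ hχχ'⟩, ?_⟩
  exact fun Ψ hΨ => LpCrossed.eq_iteratedIso hχχ' hΨ.2

theorem proposition3p1 (p : ℝ≥0∞) [Fact (1 ≤ p)] (hp : p ≠ ∞)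
    {G : Type u} [CommGroup G] [Countable G] [TopologicalSpace G] [DiscreteTopology G]
    [MeasurableSpace G] [BorelSpace G]
    [MeasurableSpace (PontryaginDual G)] [BorelSpace (PontryaginDual G)]
    (m : Measure (PontryaginDual G)) [m.IsHaarMeasure] [IsProbabilityMeasure m]
    {A : Type v} [NormedRing A] [NormedAlgebra ℂ A] [CompleteSpace A]
    [TopologicalSpace.SeparableSpace A]
    (hA : LpCrossed.IsLpOperatorAlgebra.{v, w} p A)
    (hunique : LpCrossed.HasUniqueLpMatrixNorms.{v, w} p A)
    (α : LpCrossed.IsoAction G A) :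
    ∃! Φ : LpCrossed.LpCrossedProduct.{u, max u v, w} p m
          (LpCrossed.dualAction.{u, v, w} p Measure.count α) ≃ₗᵢ[ℂ]
        LpCrossed.LpCrossedProduct.{u, max u v, w} p Measure.count
          (LpCrossed.dualTensorAction.{u, v, w} p m α),
      (∀ x y, Φ (x * y) = Φ x * Φ y) ∧
      ∀ F : C_c(PontryaginDual G × G, A),
        Φ (LpCrossed.LpCrossedProduct.ofFn p m _
            (LpCrossed.sectionMap p Measure.count α F)) =
          LpCrossed.LpCrossedProduct.ofFn p Measure.count _
            (LpCrossed.sectionMap p m (LpCrossed.IsoAction.trivial (PontryaginDual G) A)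
              (LpCrossed.labelChange F)) :=
  proposition3p1_general p Measure.count m α
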